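/- Let $k$ be a commutative ring and $A$ a (unital associative) $k$-algebra; write ${}_A\mathsf{M}$ and ${}_k\mathsf{M}$ for the categories of left $A$-modules and of $k$-modules. **Definitions.** A *(left) skew-closed category* is a category $\mathcal C$ with an object $\mathbf 1$, a bifunctor $[-,-]:\mathcal C^{op}\times\mathcal C\to\mathcal C$, a natural transformation $i_X:[\mathbf 1,X]\to X$, a dinatural transformation $j_X:\mathbf 1\to[X,X]$ and morphisms $\Gamma^X_{Y,Z}:[Y,Z]\to[[X,Y],[X,Z]]$, natural in $Y,Z$ and dinatural in $X$, such that $i_{\mathbf 1}j_{\mathbf 1}=\mathrm{id}$, $i_{[X,Y]}\circ[j_X,[X,Y]]\circ\Gamma^X_{X,Y}=\mathrm{id}$, $\Gamma^X_{Y,Y}\circ j_Y=j_{[X,Y]}$, $[[\mathbf 1,X],i_Y]\circ\Gamma^{\mathbf 1}_{X,Y}=[i_X,Y]$ and $[\Gamma^U_{V,W},[[U,V],[U,X]]]\circ\Gamma^{[U,V]}_{[U,W],[U,X]}\circ\Gamma^U_{W,X}=[[V,W],\Gamma^U_{V,X}]\circ\Gamma^V_{W,X}$. It is *normal-closed* if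 (N1) $\mathcal C(X,Y)\to\mathcal C(\mathbf 1,[X,Y])$, $f\mapsto[f,Y]\circ j_Y$, is bijective for all $X,Y$; (N2) $i$ is an isomorphism; (N3) $\int^{V\in\mathcal C}\mathcal C(U,[V,Z])\times\mathcal C(X,[Y,V])\to\mathcal C(U,[X,[Y,Z]])$, $(f,g)\mapsto[g,[Y,Z]]\circ\Gamma^Y_{V,Z}\circ f$, is bijective for all $U,X,Y,Z$. The category ${}_k\mathsf M$ is skew-closed with $[M,N]=\mathrm{Hom}_k(M,N)$, $\mathbf 1=k$, $i$ the evaluation at $1$, $j$ picking out the identity and $\Gamma$ post-composition. A *gabi-algebra structure* on $A$ is a pair of $k$-algebra maps $\varepsilon:A\to k$ and $\delta:A\to A\otimes_k A^{op}$, $\delta(a)=a_+\otimes a_-$ (summation understood), such that for all $a\in A$ $$a_+\varepsilon(a_-)=a,\qquad a_+a_-=\varepsilon(a)1,\qquad a_{++}\otimes a_{-+}\otimes a_{--}a_{+-}=a_+\otimes a_-\otimes 1 .$$ It lifts the skew-closed structure of ${}_k\mathsf M$ to ${}_A\mathsf M$: $A$ acts on $k$ through $\varepsilon$ and on $\mathrm{Hom}_k(M,N)$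 by $(a\cdot f)(m)=a_+f(a_-m)$, with $i$, $j$ and $\Gamma$ as for $k$-modules. The gabi-algebra structure is *normal* if this skew-closed structure on ${}_A\mathsf M$ is normal-closed. A *Hopf algebra structure* on $A$ is a triple $(\Delta,\varepsilon,S)$ making the given algebra $A$ a Hopf algebra over $k$ with comultiplication $\Delta$, counit $\varepsilon$ and antipode $S$. A functor $F$ between skew-closed categories is *strictly closed* if $F\mathbf 1=\mathbf 1$ and $F[X,Y]=[FX,FY]$ naturally, and the identities are compatible with $i$, $j$ and $\Gamma$. A skew-closed structure on $\mathcal C$ *underlies a (right) closed monoidal structure* if $\mathcal C$ has a monoidal structure $(\otimes,\mathbf 1)$ with the same unit object and adjunctions $-\otimes X\dashv[X,-]$, natural in $X$, under which the associator and the left and right unitors correspond to $\Gamma$, $j$ and $i$; it is *biclosed* if all functors $X\otimes-$ have right adjoints, too. A functor between closed monoidal categories is *strictly closed monoidal* if it is strictly closed, strictly monoidal, and preserves the units $X\to[Y,X\otimes Y]$ of these adjunctions. The category ${}_k\mathsf M$ carries its usual closed monoidal structure. **Theorem.** (1) There is a bijection between the normal gabi-algebra structures on $A$ and the Hopf algebra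 structures on $A$. It sends $(\varepsilon,\delta)$ to $(\Delta,\varepsilon,\sigma)$, where the map $\beta:A\otimes A\to A\otimes A$, $a\otimes b\mapsto a_+\otimes a_-b$, is bijective, $\Delta(a)=\beta^{-1}(a\otimes 1)$ and $\sigma(a)=\varepsilon(a_+)a_-$; its inverse sends $(\Delta,\varepsilon,S)$ to $(\varepsilon,\ (\mathrm{id}\otimes S)\circ\Delta)$. (2) For every skew-closed structure on ${}_A\mathsf M$ the following are equivalent: (a) it is normal-closed and the forgetful functor ${}_A\mathsf M\to{}_k\mathsf M$ is strictly closed; (b) it underlies a (right) closed monoidal structure for which the forgetful functor ${}_A\mathsf M\to{}_k\mathsf M$ is strictly closed monoidal; (c) it underlies such a structure which is moreover biclosed. In particular, ${}_A\mathsf M$ admits a normal-closed structure with strictly closed forgetful functor to ${}_k\mathsf M$ if and only if it admits a closed monoidal structure with strictly closed monoidal forgetful functor to ${}_k\mathsf M$. -/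

import Mathlib

open CategoryTheory Opposite MonoidalCategory
open scoped TensorProduct

universe u v

noncomputable section

/-! ### Skew-closed categories -/

section InternalHom

variable {C : Type u} [Category.{v} C]

/-- `[X, Y]` for a bifunctor `[-,-] : Cᵒᵖ × C ⥤ C`. -/
abbrev ihObj (H : Cᵒᵖ ⥤ C ⥤ C) (X Y : C) : C := (H.obj (op X)).obj Y

/-- `[f, g] : [X, Y] ⟶ [X', Y']` for `f : X' ⟶ X` and `g : Y ⟶ Y'`. -/
abbrev ihMap (H : Cᵒᵖ ⥤ C ⥤ C) {X X' Y Y' : C} (f : X' ⟶ X) (g : Y ⟶ Y') :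
    ihObj H X Y ⟶ ihObj H X' Y' :=
  (H.map f.op).app Y ≫ (H.obj (op X')).map g

end InternalHom

/-- A (left) skew-closed structure on a category `C`. -/
structure SkewClosed (C : Type u) [Category.{v} C] where
  /-- the unit object -/
  unit : C
  /-- the internal hom bifunctor -/
  ihom : Cᵒᵖ ⥤ C ⥤ C
  /-- the natural transformation `[1, -] ⟶ -` -/
  i : ihom.obj (op unit) ⟶ 𝟭 C
  /-- the dinatural transformation `1 ⟶ [-, -]` -/
  j (X : C) : unit ⟶ ihObj ihom X X
  /-- `Γ X Y Z` is the morphism `[Y, Z] ⟶ [[X, Y], [X, Z]]`. -/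
  Γ (X Y Z : C) : ihObj ihom Y Z ⟶ ihObj ihom (ihObj ihom X Y) (ihObj ihom X Z)
  j_dinatural {X Y : C} (f : X ⟶ Y) :
    j X ≫ ihMap ihom (𝟙 X) f = j Y ≫ ihMap ihom f (𝟙 Y)
  Γ_natural (X : C) {Y Y' Z Z' : C} (f : Y' ⟶ Y) (g : Z ⟶ Z') :
    ihMap ihom f g ≫ Γ X Y' Z' =
      Γ X Y Z ≫ ihMap ihom (ihMap ihom (𝟙 X) f) (ihMap ihom (𝟙 X) g)
  Γ_dinatural {X X' : C} (h : X ⟶ X') (Y Z : C) :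
    Γ X' Y Z ≫ ihMap ihom (𝟙 (ihObj ihom X' Y)) (ihMap ihom h (𝟙 Z)) =
      Γ X Y Z ≫ ihMap ihom (ihMap ihom h (𝟙 Y)) (𝟙 (ihObj ihom X Z))
  j_i : j unit ≫ i.app unit = 𝟙 unit
  Γ_j_i (X Y : C) :
    Γ X X Y ≫ ihMap ihom (j X) (𝟙 (ihObj ihom X Y)) ≫ i.app (ihObj ihom X Y) =
      𝟙 (ihObj ihom X Y)
  j_Γ (X Y : C) : j Y ≫ Γ X Y Y = j (ihObj ihom X Y)
  Γ_i (X Y : C) :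
    Γ unit X Y ≫ ihMap ihom (𝟙 (ihObj ihom unit X)) (i.app Y) = ihMap ihom (i.app X) (𝟙 Y)
  Γ_Γ (U V W X : C) :
    Γ U W X ≫ Γ (ihObj ihom U V) (ihObj ihom U W) (ihObj ihom U X) ≫
        ihMap ihom (Γ U V W) (𝟙 (ihObj ihom (ihObj ihom U V) (ihObj ihom U X))) =
      Γ V W X ≫ ihMap ihom (𝟙 (ihObj ihom V W)) (Γ U V X)

namespace SkewClosed

variable {C : Type u} [Category.{v} C] (S : SkewClosed C)

/-- Left normality: `C(X, Y) → C(1, [X, Y])`, `f ↦ [f, Y] ∘ j_Y`, is bijective. -/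
def LeftNormal : Prop :=
  ∀ X Y : C, Function.Bijective fun f : X ⟶ Y => S.j Y ≫ ihMap S.ihom f (𝟙 Y)

/-- Right normality: `i` is a natural isomorphism. -/
def RightNormal : Prop := IsIso S.i

/-- The disjoint union over `V` of `C(U, [V, Z]) × C(X, [Y, V])`. -/
abbrev CoendPairs (U X Y Z : C) : Type (max u v) :=
  Σ V : C, (U ⟶ ihObj S.ihom V Z) × (X ⟶ ihObj S.ihom Y V)

/-- The relation on pairs defining the coend: `([h, Z] ∘ f, g)` at `V` is identified with
`(f, [Y, h] ∘ g)` at `V'`, for `h : V ⟶ V'`. -/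
inductive CoendRel (U X Y Z : C) : S.CoendPairs U X Y Z → S.CoendPairs U X Y Z → Prop
  | glue {V V' : C} (h : V ⟶ V') (f : U ⟶ ihObj S.ihom V' Z) (g : X ⟶ ihObj S.ihom Y V) :
      CoendRel U X Y Z ⟨V, f ≫ ihMap S.ihom h (𝟙 Z), g⟩ ⟨V', f, g ≫ ihMap S.ihom (𝟙 Y) h⟩

/-- The coend of sets `∫^V C(U, [V, Z]) × C(X, [Y, V])`. -/
def Coend (U X Y Z : C) : Type (max u v) := Quot (S.CoendRel U X Y Z)

/-- The canonical map `∫^V C(U, [V, Z]) × C(X, [Y, V]) → C(U, [X, [Y, Z]])`, sending the class of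
`(f, g)` to `[g, [Y, Z]] ∘ Γ ∘ f`. -/
def Γhat (U X Y Z : C) : S.Coend U X Y Z → (U ⟶ ihObj S.ihom X (ihObj S.ihom Y Z)) :=
  Quot.lift
    (fun p => p.2.1 ≫ S.Γ Y p.1 Z ≫ ihMap S.ihom p.2.2 (𝟙 (ihObj S.ihom Y Z)))
    (by
      rintro _ _ ⟨h, f, g⟩
      have e := S.Γ_natural Y h (𝟙 Z)
      have e' : ihMap S.ihom (𝟙 Y) (𝟙 Z) = 𝟙 (ihObj S.ihom Y Z) := by simp [ihMap]
      rw [e'] at e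
      have key : ihMap S.ihom h (𝟙 Z) ≫ S.Γ Y _ Z ≫ ihMap S.ihom g (𝟙 (ihObj S.ihom Y Z)) =
          S.Γ Y _ Z ≫ ihMap S.ihom (g ≫ ihMap S.ihom (𝟙 Y) h) (𝟙 (ihObj S.ihom Y Z)) := by
        rw [← Category.assoc, e, Category.assoc]
        simp [ihMap]
      change (f ≫ ihMap S.ihom h (𝟙 Z)) ≫ S.Γ Y _ Z ≫ ihMap S.ihom g (𝟙 (ihObj S.ihom Y Z)) = _
      rw [Category.assoc, key])

/-- Associative normality: the canonical maps out of the coends are bijective. -/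
def AssocNormal : Prop := ∀ U X Y Z : C, Function.Bijective (S.Γhat U X Y Z)

/-- A skew-closed structure is normal-closed if all three normality conditions hold. -/
structure IsNormal : Prop where
  left : S.LeftNormal
  right : S.RightNormal
  assoc : S.AssocNormal

end SkewClosed

/-! ### Closed functors -/

universe u₁ v₁ u₂ v₂

/-- The structure of a closed functor on a functor between skew-closed categories. -/
structure ClosedFunctor {C : Type u₁} [Category.{v₁} C] {D : Type u₂} [Category.{v₂} D]
    (S : SkewClosed C) (T : SkewClosed D) (F : C ⥤ D) where
  F₀ : T.unit ⟶ F.obj S.unit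
  F₂ (X Y : C) : F.obj (ihObj S.ihom X Y) ⟶ ihObj T.ihom (F.obj X) (F.obj Y)
  F₂_natural {X X' Y Y' : C} (f : X' ⟶ X) (g : Y ⟶ Y') :
    F.map (ihMap S.ihom f g) ≫ F₂ X' Y' = F₂ X Y ≫ ihMap T.ihom (F.map f) (F.map g)
  j_comp (X : C) : F₀ ≫ F.map (S.j X) ≫ F₂ X X = T.j (F.obj X)
  i_comp (X : C) :
    F₂ S.unit X ≫ ihMap T.ihom F₀ (𝟙 (F.obj X)) ≫ T.i.app (F.obj X) = F.map (S.i.app X)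
  Γ_comp (X Y Z : C) :
    F.map (S.Γ Z X Y) ≫ F₂ (ihObj S.ihom Z X) (ihObj S.ihom Z Y) ≫
        ihMap T.ihom (𝟙 (F.obj (ihObj S.ihom Z X))) (F₂ Z Y) =
      F₂ X Y ≫ T.Γ (F.obj Z) (F.obj X) (F.obj Y) ≫
        ihMap T.ihom (F₂ Z X) (𝟙 (ihObj T.ihom (F.obj Z) (F.obj Y)))

/-- A morphism is an identity: source and target coincide and the morphism is the identity. -/
def IsIdentity {C : Type u} [Category.{v} C] {X Y : C} (f : X ⟶ Y) : Prop :=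
  ∃ h : X = Y, f = eqToHom h

/-- A closed functor is strict if its structure morphisms are identities. -/
structure ClosedFunctor.IsStrict {C : Type u₁} [Category.{v₁} C] {D : Type u₂} [Category.{v₂} D]
    {S : SkewClosed C} {T : SkewClosed D} {F : C ⥤ D} (Φ : ClosedFunctor S T F) : Prop where
  F₀_id : IsIdentity Φ.F₀
  F₂_id (X Y : C) : IsIdentity (Φ.F₂ X Y)

/-- The functor `F` is strictly closed. -/
def IsStrictClosed {C : Type u₁} [Category.{v₁} C] {D : Type u₂} [Category.{v₂} D]
    (S : SkewClosed C) (T : SkewClosed D) (F : C ⥤ D) : Prop :=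
  ∃ Φ : ClosedFunctor S T F, Φ.IsStrict

/-! ### Closed monoidal categories -/

/-- The skew-closed structure `S` and a monoidal structure on `C` are dual to each other: there are
adjunctions `- ⊗ X ⊣ [X, -]`, natural in `X`, under which the associator and the unitors of the
monoidal structure correspond to `Γ`, `j` and `i`. A category with such a pair of structures is
a (right) closed monoidal category. -/
structure RightClosedMonoidal {C : Type u} [Category.{v} C] (S : SkewClosed C) where
  monoidal : MonoidalCategory C
  adj (X : C) : tensorRight X ⊣ S.ihom.obj (op X)
  adj_natural {X X' : C} (f : X ⟶ X') (Y Z : C) (g : Y ⊗ X' ⟶ Z) :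
    (adj X).homEquiv Y Z (Y ◁ f ≫ g) = (adj X').homEquiv Y Z g ≫ ihMap S.ihom f (𝟙 Z)
  unit_eq : 𝟙_ C = S.unit
  leftUnitor_dual (X : C) :
    (adj X).unit.app (𝟙_ C) ≫ ihMap S.ihom (𝟙 X) (λ_ X).hom = eqToHom unit_eq ≫ S.j X
  rightUnitor_dual (X : C) :
    (ρ_ X).inv =
      (adj (𝟙_ C)).unit.app X ≫ ihMap S.ihom (eqToHom unit_eq.symm) (𝟙 (X ⊗ 𝟙_ C)) ≫
        S.i.app (X ⊗ 𝟙_ C)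
  associator_dual (X Y Z : C) :
    (adj Y).unit.app X ≫ ihMap S.ihom (𝟙 Y) ((adj Z).unit.app (X ⊗ Y)) ≫
        ihMap S.ihom (𝟙 Y) (ihMap S.ihom (𝟙 Z) (α_ X Y Z).hom) =
      (adj (Y ⊗ Z)).unit.app X ≫ S.Γ Z (Y ⊗ Z) (X ⊗ (Y ⊗ Z)) ≫
        ihMap S.ihom ((adj Z).unit.app Y) (𝟙 (ihObj S.ihom Z (X ⊗ (Y ⊗ Z))))

/-- The functors `X ⊗ -` have right adjoints as well. -/
def RightClosedMonoidal.IsBiclosed {C : Type u} [Category.{v} C] {S : SkewClosed C}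
    (M : RightClosedMonoidal S) : Prop :=
  letI := M.monoidal
  ∀ X : C, (tensorLeft X).IsLeftAdjoint

/-- The functor `F` is strictly closed monoidal: it is strictly closed and strictly monoidal, and it
preserves the units of the adjunctions `- ⊗ X ⊣ [X, -]`. -/
def IsStrictClosedMonoidal {C : Type u₁} [Category.{v₁} C] {D : Type u₂} [Category.{v₂} D]
    {S : SkewClosed C} {T : SkewClosed D} (M : RightClosedMonoidal S) (N : RightClosedMonoidal T)
    (F : C ⥤ D) : Prop :=
  letI := M.monoidal
  letI := N.monoidal
  ∃ (Φ : ClosedFunctor S T F) (L : F.LaxMonoidal),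
    Φ.IsStrict ∧ IsIdentity L.ε ∧ (∀ X Y : C, IsIdentity (L.μ X Y)) ∧
    ∀ X Y : C,
      F.map ((M.adj Y).unit.app X) ≫ Φ.F₂ Y (X ⊗ Y) =
        (N.adj (F.obj Y)).unit.app (F.obj X) ≫ ihMap T.ihom (𝟙 (F.obj Y)) (L.μ X Y)

/-! ### The closed monoidal category of modules over a commutative ring -/

section Base

variable (k : Type u) [CommRing k]

/-- The bifunctor `[M, N] = Hom_k(M, N)` on `k`-modules. -/
def baseIhom : (ModuleCat.{u} k)ᵒᵖ ⥤ ModuleCat.{u} k ⥤ ModuleCat.{u} k where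
  obj M :=
    { obj := fun N => ModuleCat.of k (M.unop →ₗ[k] N)
      map := fun g => ModuleCat.ofHom (LinearMap.compRight k g.hom) }
  map f :=
    { app := fun N => ModuleCat.ofHom (LinearMap.lcomp k N f.unop.hom) }

variable {k} in
theorem baseIhom_ihMap_apply {X X' Y Y' : ModuleCat.{u} k} (f : X' ⟶ X) (g : Y ⟶ Y')
    (φ : X →ₗ[k] Y) (x : X') :
    (show X' →ₗ[k] Y' from (ihMap (baseIhom k) f g).hom φ) x = g.hom (φ (f.hom x)) :=
  rfl

/-- The standard skew-closed structure on `k`-modules: the unit is `k`, `i` is evaluation at `1`,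
`j` picks out the identity and `Γ` is post-composition. -/
def baseSkewClosed : SkewClosed (ModuleCat.{u} k) where
  unit := ModuleCat.of k k
  ihom := baseIhom k
  i := { app := fun M => ModuleCat.ofHom (LinearMap.applyₗ (R := k) (M₂ := M) (1 : k)) }
  j M := ModuleCat.ofHom (LinearMap.toSpanSingleton k (M →ₗ[k] M) LinearMap.id)
  Γ X Y Z := ModuleCat.ofHom (LinearMap.llcomp k X Y Z)
  j_dinatural {X Y} f := by
    refine ModuleCat.hom_ext (LinearMap.ext fun r => LinearMap.ext fun x => ?_)
    change f.hom (r • x) = r • f.hom x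
    exact map_smul _ _ _
  Γ_natural _ _ _ _ _ _ _ := rfl
  Γ_dinatural _ _ _ := rfl
  j_i := by
    refine ModuleCat.hom_ext (LinearMap.ext fun r => ?_)
    exact mul_one r
  Γ_j_i X Y := by
    refine ModuleCat.hom_ext (LinearMap.ext fun φ => LinearMap.ext fun x => ?_)
    exact congrArg (show X →ₗ[k] Y from φ) (one_smul k x)
  j_Γ X Y := by
    refine ModuleCat.hom_ext (LinearMap.ext fun r => LinearMap.ext fun φ => LinearMap.ext fun x => ?_)
    rfl
  Γ_i _ _ := rfl
  Γ_Γ _ _ _ _ := rfl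

/-- The standard closed monoidal structure on `k`-modules: tensor product over `k`, with
the tensor-hom adjunction `Hom_k(M ⊗ N, P) ≃ Hom_k(M, Hom_k(N, P))`. -/
def baseClosedMonoidal : RightClosedMonoidal (baseSkewClosed k) where
  monoidal := inferInstance
  adj N := Adjunction.mkOfHomEquiv
    { homEquiv := fun M P =>
        { toFun := fun f => ModuleCat.ofHom (TensorProduct.curry f.hom)
          invFun := fun g => ModuleCat.ofHom (TensorProduct.lift g.hom)
          left_inv := fun f => by
            refine ModuleCat.hom_ext (TensorProduct.ext' fun m n => ?_)
            rfl
          right_inv := fun g => rfl }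
      homEquiv_naturality_left_symm := fun f g => by
        refine ModuleCat.hom_ext (TensorProduct.ext' fun m n => ?_)
        rfl
      homEquiv_naturality_right := fun f g => rfl }
  adj_natural f Y Z g := by
    simp only [Adjunction.mkOfHomEquiv_homEquiv]
    rfl
  unit_eq := rfl
  leftUnitor_dual X := by
    refine ModuleCat.hom_ext (LinearMap.ext fun r => LinearMap.ext fun x => ?_)
    rfl
  rightUnitor_dual X := by
    refine ModuleCat.hom_ext (LinearMap.ext fun x => ?_)
    rfl
  associator_dual X Y Z := by
    refine ModuleCat.hom_ext (LinearMap.ext fun x => LinearMap.ext fun y => LinearMap.ext fun z => ?_)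
    rfl

end Base

/-! ### Gabi-algebras -/

section Gabi

/-- The linear map `A ⊗ Aᵒᵖ → A ⊗ A` identifying the underlying modules. -/
def unopTensor (k A : Type u) [CommRing k] [Ring A] [Algebra k A] :
    A ⊗[k] Aᵐᵒᵖ →ₗ[k] A ⊗[k] A :=
  TensorProduct.map LinearMap.id (MulOpposite.opLinearEquiv k (M := A)).symm.toLinearMap

/-- The linear map `(x ⊗ y) ⊗ (z ⊗ w) ↦ (x ⊗ z) ⊗ w y`. -/
def gabiContract (k A : Type u) [CommRing k] [Ring A] [Algebra k A] :
    (A ⊗[k] A) ⊗[k] (A ⊗[k] A) →ₗ[k] (A ⊗[k] A) ⊗[k] A :=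
  TensorProduct.map LinearMap.id
      (LinearMap.mul' k A ∘ₗ (TensorProduct.comm k A A).toLinearMap) ∘ₗ
    (TensorProduct.tensorTensorTensorComm k A A A A).toLinearMap

/-- A (left) gabi-algebra structure on a `k`-algebra `A`: an augmentation `ε : A → k` and an algebra
map `δ : A → A ⊗ Aᵒᵖ`, `δ(a) = a₊ ⊗ a₋`, with `a₊ ε(a₋) = a`, `a₊ a₋ = ε(a) 1` and
`a₊₊ ⊗ a₋₊ ⊗ a₋₋ a₊₋ = a₊ ⊗ a₋ ⊗ 1`. -/
@[ext]
structure GabiStructure (k A : Type u) [CommRing k] [Ring A] [Algebra k A] where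
  ε : A →ₐ[k] k
  δ : A →ₐ[k] A ⊗[k] Aᵐᵒᵖ
  counitality (a : A) :
    TensorProduct.rid k A (TensorProduct.map LinearMap.id ε.toLinearMap (unopTensor k A (δ a))) = a
  mul_plus_minus (a : A) :
    LinearMap.mul' k A (unopTensor k A (δ a)) = algebraMap k A (ε a)
  associativity (a : A) :
    gabiContract k A
        (TensorProduct.map (unopTensor k A ∘ₗ δ.toLinearMap) (unopTensor k A ∘ₗ δ.toLinearMap)
          (unopTensor k A (δ a))) =
      unopTensor k A (δ a) ⊗ₜ[k] (1 : A)

section Action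

variable (k : Type u) {A : Type u} [CommRing k] [Ring A] [Algebra k A]
variable (M N : Type u) [AddCommGroup M] [Module k M] [Module A M] [IsScalarTower k A M]
variable [AddCommGroup N] [Module k N] [Module A N] [IsScalarTower k A N]

/-- The action of `A` on `Hom_k(M, N)` by post-composition, `(a f)(m) = a f(m)`. -/
def postAction : A →ₐ[k] Module.End k (M →ₗ[k] N) :=
  AlgHom.ofLinearMap
    (LinearMap.mk₂ k (fun a f => Algebra.lsmul k k N a ∘ₗ f)
      (fun a b f => by ext m; simp)
      (fun r a f => by ext m; simp)
      (fun a f g => by ext m; simp)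
      (fun r a f => by ext m; exact smul_algebra_smul_comm r a (f m)))
    (by ext f m; simp)
    (fun a b => by ext f m; simp)

/-- The action of `Aᵒᵖ` on `Hom_k(M, N)` by pre-composition, `(b f)(m) = f(b m)`. -/
def preAction : Aᵐᵒᵖ →ₐ[k] Module.End k (M →ₗ[k] N) :=
  AlgHom.ofLinearMap
    (LinearMap.mk₂ k (fun b f => f ∘ₗ Algebra.lsmul k k M b.unop)
      (fun a b f => by ext m; simp)
      (fun r a f => by ext m; simp)
      (fun a f g => by ext m; simp)
      (fun r a f => by ext m; simp))
    (by ext f m; simp)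
    (fun a b => by ext f m; simp)

/-- The action of `A ⊗ Aᵒᵖ` on `Hom_k(M, N)`, `((a ⊗ b) f)(m) = a f(b m)`. -/
def twoSidedAction : A ⊗[k] Aᵐᵒᵖ →ₐ[k] Module.End k (M →ₗ[k] N) :=
  Algebra.TensorProduct.lift (postAction k M N) (preAction k M N)
    (fun a b => by
      ext f m
      rfl)

theorem twoSidedAction_tmul (a : A) (b : Aᵐᵒᵖ) (f : M →ₗ[k] N) (m : M) :
    twoSidedAction k M N (a ⊗ₜ b) f m = a • f (b.unop • m) := by
  simp [twoSidedAction]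
  rfl

variable {M N}

theorem twoSidedAction_id (t : A ⊗[k] Aᵐᵒᵖ) (m : M) :
    twoSidedAction k M M t LinearMap.id m = LinearMap.mul' k A (unopTensor k A t) • m := by
  induction t with
  | zero => simp
  | add x y hx hy => simp only [map_add, LinearMap.add_apply, hx, hy, add_smul]
  | tmul a b =>
    rw [twoSidedAction_tmul]
    exact (mul_smul a b.unop m).symm

theorem twoSidedAction_eval (e : A →ₐ[k] k) (m : M) (hm : ∀ a : A, a • m = e a • m)
    (φ : M →ₗ[k] N) (t : A ⊗[k] Aᵐᵒᵖ) :
    twoSidedAction k M N t φ m =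
      TensorProduct.rid k A (TensorProduct.map LinearMap.id e.toLinearMap (unopTensor k A t)) •
        φ m := by
  induction t with
  | zero => simp
  | add x y hx hy => simp only [map_add, LinearMap.add_apply, hx, hy, add_smul]
  | tmul a b =>
    rw [twoSidedAction_tmul, hm, map_smul, smul_algebra_smul_comm]
    exact (smul_assoc (e b.unop) a (φ m)).symm

variable {P : Type u} [AddCommGroup P] [Module k P] [Module A P] [IsScalarTower k A P]

/-- The linear map `(p ⊗ q) ⊗ r ↦ p φ(q ψ(r m))`. -/
def tripleAction (φ : N →ₗ[k] P) (ψ : M →ₗ[k] N) (m : M) : (A ⊗[k] A) ⊗[k] A →ₗ[k] P :=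
  TensorProduct.lift
    (LinearMap.compl₂
      ((LinearMap.applyₗ φ ∘ₗ (twoSidedAction (A := A) k N P).toLinearMap) ∘ₗ
        TensorProduct.map LinearMap.id (MulOpposite.opLinearEquiv k (M := A)).toLinearMap)
      (ψ ∘ₗ (LinearMap.toSpanSingleton A M m).restrictScalars k))

theorem tripleAction_tmul (φ : N →ₗ[k] P) (ψ : M →ₗ[k] N) (m : M) (p q r : A) :
    tripleAction k φ ψ m ((p ⊗ₜ q) ⊗ₜ r) = p • φ (q • ψ (r • m)) :=
  twoSidedAction_tmul k N P p (MulOpposite.op q) φ (ψ (r • m))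

theorem tripleAction_one (φ : N →ₗ[k] P) (ψ : M →ₗ[k] N) (m : M) (t : A ⊗[k] Aᵐᵒᵖ) :
    tripleAction k φ ψ m (unopTensor k A t ⊗ₜ 1) = twoSidedAction k N P t φ (ψ m) := by
  induction t with
  | zero => simp
  | add x y hx hy => simp only [map_add, LinearMap.add_apply, TensorProduct.add_tmul, hx, hy]
  | tmul a b =>
    rw [twoSidedAction_tmul]
    refine (tripleAction_tmul k φ ψ m a b.unop 1).trans ?_
    rw [one_smul]

theorem tripleAction_contract (φ : N →ₗ[k] P) (ψ : M →ₗ[k] N) (m : M) (s t : A ⊗[k] Aᵐᵒᵖ) :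
    tripleAction k φ ψ m (gabiContract k A (unopTensor k A s ⊗ₜ unopTensor k A t)) =
      twoSidedAction k M P s (φ ∘ₗ twoSidedAction k M N t ψ) m := by
  induction s with
  | zero => simp
  | add x y hx hy => simp only [map_add, LinearMap.add_apply, TensorProduct.add_tmul, hx, hy]
  | tmul p b =>
    induction t with
    | zero => simp
    | add x y hx hy =>
      simp only [map_add, LinearMap.add_apply, TensorProduct.tmul_add, hx, hy, LinearMap.comp_add]
    | tmul q c =>
      rw [twoSidedAction_tmul, LinearMap.comp_apply, twoSidedAction_tmul, ← mul_smul]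
      exact tripleAction_tmul k φ ψ m p q (c.unop * b.unop)

end Action

variable (k A : Type u) [CommRing k] [Ring A] [Algebra k A]

/-- The forgetful functor from `A`-modules to `k`-modules. -/
abbrev forgetToBase : ModuleCat.{u} A ⥤ ModuleCat.{u} k :=
  ModuleCat.restrictScalars (algebraMap k A)

variable {A}

instance forgetToBase_isScalarTower (M : ModuleCat.{u} A) :
    IsScalarTower k A ((forgetToBase k A).obj M) where
  smul_assoc r a m := by
    change (r • a) • (show M from m) = algebraMap k A r • a • (show M from m)
    rw [Algebra.smul_def, mul_smul]

variable {k}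

/-- The action of `A` on `Hom_k(M, N)` given by `(a f)(m) = a₊ f(a₋ m)`. -/
def GabiStructure.action (G : GabiStructure k A) (M N : ModuleCat.{u} A) :
    A →ₐ[k] Module.End k ((forgetToBase k A).obj M →ₗ[k] (forgetToBase k A).obj N) :=
  (twoSidedAction k ((forgetToBase k A).obj M) ((forgetToBase k A).obj N)).comp G.δ

/-- The `k`-module `Hom_k(M, N)`, as carrier of the `A`-module `[M, N]`. -/
def GabiStructure.Hom (_G : GabiStructure k A) (M N : ModuleCat.{u} A) : Type u :=
  (forgetToBase k A).obj M →ₗ[k] (forgetToBase k A).obj N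

namespace GabiStructure

variable (G : GabiStructure k A)

instance (M N : ModuleCat.{u} A) : AddCommGroup (G.Hom M N) :=
  inferInstanceAs
    (AddCommGroup ((forgetToBase k A).obj M →ₗ[k] (forgetToBase k A).obj N))

instance (M N : ModuleCat.{u} A) : Module A (G.Hom M N) :=
  Module.compHom ((forgetToBase k A).obj M →ₗ[k] (forgetToBase k A).obj N)
    (G.action M N).toRingHom

theorem smul_def {M N : ModuleCat.{u} A} (a : A) (f : G.Hom M N) :
    a • f = G.action M N a f := rfl

theorem algebraMap_smul {M N : ModuleCat.{u} A} (r : k) (f : G.Hom M N) :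
    algebraMap k A r • f =
      (r • (show (forgetToBase k A).obj M →ₗ[k] (forgetToBase k A).obj N from f) :
        (forgetToBase k A).obj M →ₗ[k] (forgetToBase k A).obj N) := by
  rw [smul_def, AlgHom.commutes]
  rfl

/-- An element of `[M, N]`, as a `k`-linear map. -/
abbrev toLin {M N : ModuleCat.{u} A} (φ : G.Hom M N) :
    (forgetToBase k A).obj M →ₗ[k] (forgetToBase k A).obj N := φ

/-- The `A`-module `[M, N]`. -/
abbrev homObj (M N : ModuleCat.{u} A) : ModuleCat.{u} A := ModuleCat.of A (G.Hom M N)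

theorem twoSidedAction_natural {M M' N N' : ModuleCat.{u} A} (f : M' ⟶ M) (g : N ⟶ N')
    (t : A ⊗[k] Aᵐᵒᵖ) (φ : (forgetToBase k A).obj M →ₗ[k] (forgetToBase k A).obj N) :
    ((forgetToBase k A).map g).hom ∘ₗ twoSidedAction k _ _ t φ ∘ₗ ((forgetToBase k A).map f).hom =
      twoSidedAction k ((forgetToBase k A).obj M') ((forgetToBase k A).obj N') t
        (((forgetToBase k A).map g).hom ∘ₗ φ ∘ₗ ((forgetToBase k A).map f).hom) := by
  induction t with
  | zero => ext; simp
  | add x y hx hy =>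
    simp only [map_add, LinearMap.add_apply, LinearMap.add_comp, LinearMap.comp_add, hx, hy]
  | tmul a b =>
    refine LinearMap.ext fun m => ?_
    simp only [LinearMap.comp_apply, twoSidedAction_tmul]
    exact (g.hom.map_smul a _).trans
      (congrArg (fun x => a • g.hom (φ x)) (f.hom.map_smul b.unop m).symm)

/-- `[f, g] : [M, N] ⟶ [M', N']`, `φ ↦ g ∘ φ ∘ f`. -/
def homMap {M M' N N' : ModuleCat.{u} A} (f : M' ⟶ M) (g : N ⟶ N') :
    G.homObj M N ⟶ G.homObj M' N' :=
  ModuleCat.ofHom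
    { toFun := fun φ =>
        ((forgetToBase k A).map g).hom ∘ₗ
          G.toLin φ ∘ₗ ((forgetToBase k A).map f).hom
      map_add' := fun φ ψ => by
        refine LinearMap.ext fun m => ?_
        exact g.hom.map_add _ _
      map_smul' := fun a φ => twoSidedAction_natural f g (G.δ a) φ }

/-- The bifunctor `[M, N] = Hom_k(M, N)` on `A`-modules. -/
def ihom : (ModuleCat.{u} A)ᵒᵖ ⥤ ModuleCat.{u} A ⥤ ModuleCat.{u} A where
  obj M :=
    { obj := fun N => G.homObj M.unop N
      map := fun g => G.homMap (𝟙 M.unop) g }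
  map f :=
    { app := fun N => G.homMap f.unop (𝟙 N) }

/-- The base ring `k`, as carrier of the trivial `A`-module `k`. -/
def Unit (_G : GabiStructure k A) : Type u := k

instance : AddCommGroup G.Unit := inferInstanceAs (AddCommGroup k)

instance : Module A G.Unit := Module.compHom k G.ε.toRingHom

/-- The trivial `A`-module `k`, with action through `ε`. -/
abbrev unitObj : ModuleCat.{u} A := ModuleCat.of A G.Unit

theorem smul_one_unitObj (a : A) :
    a • (show (forgetToBase k A).obj G.unitObj from (1 : k)) =
      G.ε a • (show (forgetToBase k A).obj G.unitObj from (1 : k)) := by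
  change G.ε a * (1 : k) = G.ε (algebraMap k A (G.ε a)) * (1 : k)
  rw [AlgHom.commutes]
  rfl

/-- Evaluation at `1`, as a morphism `[k, M] ⟶ M`. -/
def iMap (M : ModuleCat.{u} A) : G.homObj G.unitObj M ⟶ M :=
  ModuleCat.ofHom
    { toFun := fun φ => G.toLin φ (1 : k)
      map_add' := fun _ _ => rfl
      map_smul' := fun a φ =>
        (twoSidedAction_eval k G.ε _ G.smul_one_unitObj (G.toLin φ) (G.δ a)).trans
          (congrArg (fun x : A => x • G.toLin φ (1 : k)) (G.counitality a)) }

/-- The morphism `k ⟶ [M, M]` picking out the identity. -/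
def jMap (M : ModuleCat.{u} A) : G.unitObj ⟶ G.homObj M M :=
  ModuleCat.ofHom
    { toFun := fun r => LinearMap.toSpanSingleton k
        ((forgetToBase k A).obj M →ₗ[k] (forgetToBase k A).obj M) LinearMap.id r
      map_add' := fun r s => (LinearMap.toSpanSingleton k
        ((forgetToBase k A).obj M →ₗ[k] (forgetToBase k A).obj M) LinearMap.id).map_add r s
      map_smul' := fun a r => by
        refine LinearMap.ext fun m => ?_
        change (G.ε a * (show k from r)) • m = twoSidedAction k ((forgetToBase k A).obj M)
          ((forgetToBase k A).obj M) (G.δ a) ((show k from r) • LinearMap.id) m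
        rw [map_smul, mul_comm, mul_smul]
        refine congrArg (fun x : (forgetToBase k A).obj M => (show k from r) • x) ?_
        refine Eq.trans ?_ (twoSidedAction_id k (G.δ a) m).symm
        rw [G.mul_plus_minus a]
        rfl }

variable {G} in
/-- Post-composition with `φ`, as a `k`-linear map `[M, N] → [M, P]`. -/
def postComp (M : ModuleCat.{u} A) {N P : ModuleCat.{u} A} (φ : G.Hom N P) :
    (forgetToBase k A).obj (G.homObj M N) →ₗ[k] (forgetToBase k A).obj (G.homObj M P) where
  toFun ψ := G.toLin φ ∘ₗ G.toLin ψ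
  map_add' _ _ := LinearMap.comp_add _ _ _
  map_smul' r ψ := by
    refine LinearMap.ext fun m => ?_
    change G.toLin φ (G.toLin (algebraMap k A r • (show G.Hom M N from ψ)) m) =
      G.toLin (algebraMap k A r • (show G.Hom M P from G.toLin φ ∘ₗ G.toLin ψ)) m
    rw [algebraMap_smul, algebraMap_smul]
    exact map_smul (G.toLin φ) r _

/-- Post-composition, as a morphism `[N, P] ⟶ [[M, N], [M, P]]`. -/
def ΓMap (M N P : ModuleCat.{u} A) :
    G.homObj N P ⟶ G.homObj (G.homObj M N) (G.homObj M P) :=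
  ModuleCat.ofHom
    { toFun := fun φ => postComp M φ
      map_add' := fun _ _ => rfl
      map_smul' := fun a φ => by
        refine LinearMap.ext fun ψ => LinearMap.ext fun m => ?_
        have key : ∀ t : A ⊗[k] Aᵐᵒᵖ,
            tripleAction k (G.toLin φ) (G.toLin ψ) m (gabiContract k A
              (TensorProduct.map (unopTensor k A ∘ₗ G.δ.toLinearMap)
                (unopTensor k A ∘ₗ G.δ.toLinearMap) (unopTensor k A t))) =
            G.toLin (twoSidedAction k ((forgetToBase k A).obj (G.homObj M N))
              ((forgetToBase k A).obj (G.homObj M P)) t (postComp (G := G) M φ) ψ) m := by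
          intro t
          induction t with
          | zero => simp; rfl
          | add x y hx hy =>
            simp only [map_add, hx, hy]
            rfl
          | tmul p b =>
            refine Eq.trans ?_ (congrArg (fun χ => G.toLin χ m)
              (twoSidedAction_tmul k _ _ p b (postComp (G := G) M φ) ψ).symm)
            exact tripleAction_contract k (G.toLin φ) (G.toLin ψ) m (G.δ p) (G.δ b.unop)
        refine Eq.trans ?_ (key (G.δ a))
        rw [G.associativity a]
        exact (tripleAction_one k (G.toLin φ) (G.toLin ψ) m (G.δ a)).symm }

/-- The skew-closed structure on `A`-modules lifted from `k`-modules along the forgetful functor. -/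
def skewClosed : SkewClosed (ModuleCat.{u} A) where
  unit := G.unitObj
  ihom := G.ihom
  i := { app := G.iMap }
  j := G.jMap
  Γ := G.ΓMap
  j_dinatural {X Y} f := by
    refine ModuleCat.hom_ext (LinearMap.ext fun r => LinearMap.ext fun x => ?_)
    exact ((forgetToBase k A).map f).hom.map_smul (show k from r) x
  Γ_natural _ _ _ _ _ _ _ := rfl
  Γ_dinatural _ _ _ := rfl
  j_i := by
    refine ModuleCat.hom_ext (LinearMap.ext fun r => ?_)
    change G.ε (algebraMap k A (show k from r)) * (1 : k) = (show k from r)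
    rw [AlgHom.commutes]
    exact mul_one (show k from r)
  Γ_j_i X Y := by
    refine ModuleCat.hom_ext (LinearMap.ext fun φ => LinearMap.ext fun x => ?_)
    exact congrArg (G.toLin φ) (one_smul k x)
  j_Γ X Y := by
    refine ModuleCat.hom_ext (LinearMap.ext fun r => LinearMap.ext fun φ => LinearMap.ext fun x => ?_)
    exact (congrArg (fun χ => G.toLin χ x)
      (G.algebraMap_smul (show k from r) (show G.Hom X Y from φ))).symm
  Γ_i _ _ := rfl
  Γ_Γ _ _ _ _ := rfl

/-- The canonical map `β : A ⊗ A → A ⊗ A`, `a ⊗ b ↦ a₊ ⊗ a₋ b`. -/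
def canonicalMap : A ⊗[k] A →ₗ[k] A ⊗[k] A :=
  TensorProduct.map LinearMap.id (LinearMap.mul' k A) ∘ₗ
    (TensorProduct.assoc k A A A).toLinearMap ∘ₗ
      TensorProduct.map (unopTensor k A ∘ₗ G.δ.toLinearMap) LinearMap.id

/-- The map `σ : A → A`, `σ(a) = ε(a₊) a₋`. -/
def antipode : A →ₗ[k] A :=
  (TensorProduct.lid k A).toLinearMap ∘ₗ
    TensorProduct.map G.ε.toLinearMap LinearMap.id ∘ₗ unopTensor k A ∘ₗ G.δ.toLinearMap

end GabiStructure

variable (k A)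

/-- A normal gabi-algebra structure on `A` is a gabi-algebra structure for which the lifted
skew-closed structure on `A`-modules is normal. -/
def NormalGabiStructure : Type u := {G : GabiStructure k A // G.skewClosed.IsNormal}

end Gabi

/-! ### Hopf algebra structures on a given algebra -/

/-- A Hopf algebra structure on a given `k`-algebra `A`. -/
structure HopfStructure (k A : Type u) [CommRing k] [Ring A] [Algebra k A] extends
    Coalgebra k A where
  counit_one : counit 1 = 1
  counit_mul (a b : A) : counit (a * b) = counit a * counit b
  comul_one : comul 1 = 1
  comul_mul (a b : A) : comul (a * b) = comul a * comul b
  antipode : A →ₗ[k] A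
  mul_antipode_left :
    LinearMap.mul' k A ∘ₗ antipode.rTensor A ∘ₗ comul = Algebra.linearMap k A ∘ₗ counit
  mul_antipode_right :
    LinearMap.mul' k A ∘ₗ antipode.lTensor A ∘ₗ comul = Algebra.linearMap k A ∘ₗ counit

/-- The Hopf algebra in the sense of Mathlib, on the same algebra `A`. -/
@[reducible]
def HopfStructure.toHopfAlgebra {k A : Type u} [CommRing k] [Ring A] [Algebra k A]
    (H : HopfStructure k A) : HopfAlgebra k A :=
  letI := H.toCoalgebra
  letI := Bialgebra.mk' k A H.counit_one (fun {a b} => H.counit_mul a b) H.comul_one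
    (fun {a b} => H.comul_mul a b)
  { antipode := H.antipode
    mul_antipode_rTensor_comul := H.mul_antipode_left
    mul_antipode_lTensor_comul := H.mul_antipode_right }

theorem HopfStructure.toHopfAlgebra_toAlgebra {k A : Type u} [CommRing k] [Ring A]
    [inst : Algebra k A] (H : HopfStructure k A) : H.toHopfAlgebra.toAlgebra = inst := rfl

end

/-! Along a closed functor to `k`-modules with invertible comparison maps, the internal hom of
`A`-modules is `Hom_k` and its structure maps are the usual ones. Hence everything turns on whether
the tensor product over `k` lifts to `A`-modules as the representing object of `Hom(X, [Y, -])`;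
such a lifting is a `TensorLift`. It makes `A`-modules a right closed monoidal category, with
coherence inherited through the faithful forgetful functor.

For part (2), every right closed monoidal structure is normal: (N1), (N2), (N3) are the left unitor,
right unitor and associator seen through the adjunctions, the coend in (N3) being computed by the
co-Yoneda lemma. Conversely, `[Y, -]` preserves limits and `A`-modules have a coseparator, so there
are universal morphisms `X ⟶ [Y, P]`. By (N3), composing with the induced map `X ⊗ Y → P` is
bijective on `k`-linear maps into every `A`-module; testing on enough modules shows that the map
itself is bijective (`tensorMap_bijective`), and transport of structure makes the comparison an
identity. Biclosedness is the dual adjoint functor argument for `X ⊗ -`.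

For part (1), normality is equivalent to bijectivity of `β`. If `β` is bijective, then `Δ(a) = β⁻¹(a
⊗ 1)` is an algebra map and its diagonal action lifts tensor products. If the structure is normal,
the lifted tensor square of the regular module is compared with the free module `A ⊗ A`, and `β` is
exactly this comparison (`bijective_of_isNormal`). For bijective `β` the gabi axioms become the Hopf
axioms: the two counit laws and the antipode laws come from applying `ε` or multiplication to `β`,
and the third gabi axiom corresponds to coassociativity through the pentagon identity for `β⁻¹`
(`gabiContract_of_coassoc`, `coassoc_of_gabiContract`). -/

noncomputable section

/-! ### Closed functors to modules over the base ring, elementwise -/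

section BaseMap

variable (k : Type u) {A : Type u} [CommRing k] [Ring A] [Algebra k A]

/-- The `k`-linear map underlying a morphism of `A`-modules. -/
def baseMap {X Y : ModuleCat.{u} A} (f : X ⟶ Y) :
    (forgetToBase k A).obj X →ₗ[k] (forgetToBase k A).obj Y :=
  ((forgetToBase k A).map f).hom

@[simp]
theorem baseMap_comp {X Y Z : ModuleCat.{u} A} (f : X ⟶ Y) (g : Y ⟶ Z)
    (x : (forgetToBase k A).obj X) : baseMap k (f ≫ g) x = baseMap k g (baseMap k f x) := rfl

@[simp]
theorem baseMap_id {X : ModuleCat.{u} A} (x : (forgetToBase k A).obj X) :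
    baseMap k (𝟙 X) x = x := rfl

theorem baseMap_injective {X Y : ModuleCat.{u} A} {f g : X ⟶ Y}
    (h : ∀ x, baseMap k f x = baseMap k g x) : f = g :=
  (forgetToBase k A).map_injective (ModuleCat.hom_ext (LinearMap.ext h))

theorem baseMap_smul {X Y : ModuleCat.{u} A} (f : X ⟶ Y) (a : A)
    (x : (forgetToBase k A).obj X) : baseMap k f (a • x) = a • baseMap k f x :=
  f.hom.map_smul a x

/-- An `A`-linear map between the underlying modules is a morphism of `A`-modules. -/
def homOfBase {X Y : ModuleCat.{u} A}
    (f : (forgetToBase k A).obj X →ₗ[k] (forgetToBase k A).obj Y)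
    (h : ∀ (a : A) x, f (a • x) = a • f x) : X ⟶ Y :=
  ModuleCat.ofHom
    { toFun := f
      map_add' := fun x y => f.map_add x y
      map_smul' := h }

end BaseMap

namespace ClosedFunctor

variable {k A : Type u} [CommRing k] [Ring A] [Algebra k A]
variable {S : SkewClosed (ModuleCat.{u} A)}
variable (Φ : ClosedFunctor S (baseSkewClosed k) (forgetToBase k A))

/-- An element of `[X, Y]`, as a `k`-linear map `X → Y`. -/
def val (X Y : ModuleCat.{u} A) : (forgetToBase k A).obj (ihObj S.ihom X Y) →ₗ[k]
    ((forgetToBase k A).obj X →ₗ[k] (forgetToBase k A).obj Y) :=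
  (Φ.F₂ X Y).hom

/-- The comparison of unit objects. -/
def unitMap : k →ₗ[k] (forgetToBase k A).obj S.unit := Φ.F₀.hom

-- Read through `val`, the structure of `S` is that of `k`-modules. This lemma and those after it
-- are the closed functor axioms in elementwise form; they reduce identities between morphisms into
-- internal homs to computations with `k`-linear maps.
@[simp]
theorem val_ihMap {X X' Y Y' : ModuleCat.{u} A} (f : X' ⟶ X) (g : Y ⟶ Y')
    (p : (forgetToBase k A).obj (ihObj S.ihom X Y)) (x : (forgetToBase k A).obj X') :
    Φ.val X' Y' (baseMap k (ihMap S.ihom f g) p) x =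
      baseMap k g (Φ.val X Y p (baseMap k f x)) := by
  have h := congrArg (fun q => q.hom p) (Φ.F₂_natural f g)
  exact congrArg (fun q : (forgetToBase k A).obj X' →ₗ[k] (forgetToBase k A).obj Y' => q x) h

@[simp]
theorem val_ihom_map {X Y Y' : ModuleCat.{u} A} (g : Y ⟶ Y')
    (p : (forgetToBase k A).obj (ihObj S.ihom X Y)) (x : (forgetToBase k A).obj X) :
    Φ.val X Y' (baseMap k ((S.ihom.obj (op X)).map g) p) x = baseMap k g (Φ.val X Y p x) := by
  have h : (S.ihom.obj (op X)).map g = ihMap S.ihom (𝟙 X) g := by simp [ihMap]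
  rw [h, val_ihMap, baseMap_id]

@[simp]
theorem val_ihom_map_app {X X' Y : ModuleCat.{u} A} (f : X' ⟶ X)
    (p : (forgetToBase k A).obj (ihObj S.ihom X Y)) (x : (forgetToBase k A).obj X') :
    Φ.val X' Y (baseMap k ((S.ihom.map f.op).app Y) p) x = Φ.val X Y p (baseMap k f x) := by
  have h : (S.ihom.map f.op).app Y = ihMap S.ihom f (𝟙 Y) := by simp [ihMap]
  rw [h, val_ihMap, baseMap_id]

@[simp]
theorem val_j (X : ModuleCat.{u} A) (r : k) (x : (forgetToBase k A).obj X) :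
    Φ.val X X (baseMap k (S.j X) (Φ.unitMap r)) x = r • x := by
  have h := congrArg (fun q => q.hom r) (Φ.j_comp X)
  exact congrArg (fun q : (forgetToBase k A).obj X →ₗ[k] (forgetToBase k A).obj X => q x) h

theorem baseMap_i (X : ModuleCat.{u} A) (p : (forgetToBase k A).obj (ihObj S.ihom S.unit X)) :
    baseMap k (S.i.app X) p = Φ.val S.unit X p (Φ.unitMap 1) :=
  (congrArg (fun q => q.hom p) (Φ.i_comp X)).symm

@[simp]
theorem val_Γ (X Y Z : ModuleCat.{u} A) (p : (forgetToBase k A).obj (ihObj S.ihom Y Z))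
    (q : (forgetToBase k A).obj (ihObj S.ihom X Y)) (x : (forgetToBase k A).obj X) :
    Φ.val X Z (Φ.val _ _ (baseMap k (S.Γ X Y Z) p) q) x = Φ.val Y Z p (Φ.val X Y q x) := by
  have h := congrArg (fun q => q.hom p) (Φ.Γ_comp Y Z X)
  have h' := congrArg (fun r : (forgetToBase k A).obj (ihObj S.ihom X Y) →ₗ[k]
    ((forgetToBase k A).obj X →ₗ[k] (forgetToBase k A).obj Z) => r q) h
  exact congrArg (fun q : (forgetToBase k A).obj X →ₗ[k] (forgetToBase k A).obj Z => q x) h'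

/-- A closed functor is strong if its structure morphisms are invertible. -/
structure IsStrong : Prop where
  isIso_F₀ : IsIso Φ.F₀
  isIso_F₂ (X Y : ModuleCat.{u} A) : IsIso (Φ.F₂ X Y)

variable {Φ}

theorem IsStrict.isStrong (h : Φ.IsStrict) : Φ.IsStrong where
  isIso_F₀ := by
    obtain ⟨e, he⟩ := h.F₀_id
    rw [he]
    infer_instance
  isIso_F₂ X Y := by
    obtain ⟨e, he⟩ := h.F₂_id X Y
    rw [he]
    infer_instance

namespace IsStrong

theorem val_bijective (h : Φ.IsStrong) (X Y : ModuleCat.{u} A) :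
    Function.Bijective (Φ.val X Y) := by
  have := h.isIso_F₂ X Y
  exact ConcreteCategory.bijective_of_isIso (Φ.F₂ X Y)

theorem unitMap_bijective (h : Φ.IsStrong) : Function.Bijective Φ.unitMap := by
  have := h.isIso_F₀
  exact ConcreteCategory.bijective_of_isIso Φ.F₀

theorem val_ext (h : Φ.IsStrong) {X Y : ModuleCat.{u} A}
    {p q : (forgetToBase k A).obj (ihObj S.ihom X Y)}
    (hpq : ∀ x, Φ.val X Y p x = Φ.val X Y q x) : p = q :=
  (h.val_bijective X Y).1 (LinearMap.ext hpq)

theorem hom_ext (h : Φ.IsStrong) {W X Y : ModuleCat.{u} A} {f g : W ⟶ ihObj S.ihom X Y}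
    (hfg : ∀ w x, Φ.val X Y (baseMap k f w) x = Φ.val X Y (baseMap k g w) x) : f = g :=
  baseMap_injective k fun w => h.val_ext (hfg w)

end IsStrong

variable (Φ)

/-- Modules lifting the tensor products of the underlying `k`-modules, which represent the functors
`Hom(X, [Y, -])`. -/
structure TensorLift where
  obj (X Y : ModuleCat.{u} A) : ModuleCat.{u} A
  μ (X Y : ModuleCat.{u} A) : (forgetToBase k A).obj X ⊗[k] (forgetToBase k A).obj Y ≃ₗ[k]
    (forgetToBase k A).obj (obj X Y)
  η (X Y : ModuleCat.{u} A) : X ⟶ ihObj S.ihom Y (obj X Y)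
  val_η (X Y : ModuleCat.{u} A) (x : (forgetToBase k A).obj X) (y : (forgetToBase k A).obj Y) :
    Φ.val Y (obj X Y) (baseMap k (η X Y) x) y = μ X Y (x ⊗ₜ y)
  lift {X Y Z : ModuleCat.{u} A} (g : X ⟶ ihObj S.ihom Y Z) : obj X Y ⟶ Z
  lift_μ {X Y Z : ModuleCat.{u} A} (g : X ⟶ ihObj S.ihom Y Z) (x : (forgetToBase k A).obj X)
    (y : (forgetToBase k A).obj Y) :
    baseMap k (lift g) (μ X Y (x ⊗ₜ y)) = Φ.val Y Z (baseMap k g x) y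

end ClosedFunctor

/-! ### The closed monoidal category of modules given by lifted tensor products -/

namespace ClosedFunctor.TensorLift

variable {k A : Type u} [CommRing k] [Ring A] [Algebra k A]
variable {S : SkewClosed (ModuleCat.{u} A)}
variable {Φ : ClosedFunctor S (baseSkewClosed k) (forgetToBase k A)}
variable (T : Φ.TensorLift)

attribute [simp] val_η lift_μ

theorem hom_ext {X Y Z : ModuleCat.{u} A} {f g : T.obj X Y ⟶ Z}
    (h : ∀ x y, baseMap k f (T.μ X Y (x ⊗ₜ y)) = baseMap k g (T.μ X Y (x ⊗ₜ y))) : f = g := by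
  refine (forgetToBase k A).map_injective ((cancel_epi (T.μ X Y).toModuleIso.hom).1 ?_)
  exact ModuleCat.hom_ext (TensorProduct.ext' h)

/-- The adjunction isomorphism. -/
def homEquiv (hΦ : Φ.IsStrong) (X Y Z : ModuleCat.{u} A) :
    (T.obj X Y ⟶ Z) ≃ (X ⟶ ihObj S.ihom Y Z) where
  toFun f := T.η X Y ≫ ihMap S.ihom (𝟙 Y) f
  invFun g := T.lift g
  left_inv f := T.hom_ext fun x y => by simp
  right_inv g := hΦ.hom_ext fun x y => by simp

@[simp]
theorem val_homEquiv (hΦ : Φ.IsStrong) {X Y Z : ModuleCat.{u} A} (f : T.obj X Y ⟶ Z)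
    (x : (forgetToBase k A).obj X) (y : (forgetToBase k A).obj Y) :
    Φ.val Y Z (baseMap k (T.homEquiv hΦ X Y Z f) x) y = baseMap k f (T.μ X Y (x ⊗ₜ y)) := by
  simp [homEquiv]

/-- The morphism underlying the associator. -/
def assocHom (X Y Z : ModuleCat.{u} A) : T.obj (T.obj X Y) Z ⟶ T.obj X (T.obj Y Z) :=
  T.lift (T.lift (T.η X (T.obj Y Z) ≫ S.Γ Z (T.obj Y Z) (T.obj X (T.obj Y Z)) ≫
    ihMap S.ihom (T.η Y Z) (𝟙 (ihObj S.ihom Z (T.obj X (T.obj Y Z))))))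

@[simp]
theorem assocHom_μ (X Y Z : ModuleCat.{u} A) (x : (forgetToBase k A).obj X)
    (y : (forgetToBase k A).obj Y) (z : (forgetToBase k A).obj Z) :
    baseMap k (T.assocHom X Y Z) (T.μ _ Z (T.μ X Y (x ⊗ₜ y) ⊗ₜ z)) =
      T.μ X _ (x ⊗ₜ T.μ Y Z (y ⊗ₜ z)) := by
  simp [assocHom]

/-- The morphism underlying the left unitor. -/
def leftUnitorHom (X : ModuleCat.{u} A) : T.obj S.unit X ⟶ X := T.lift (S.j X)

@[simp]
theorem leftUnitorHom_μ (X : ModuleCat.{u} A) (r : k) (x : (forgetToBase k A).obj X) :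
    baseMap k (T.leftUnitorHom X) (T.μ S.unit X (Φ.unitMap r ⊗ₜ x)) = r • x := by
  rw [leftUnitorHom, T.lift_μ, Φ.val_j]

/-- The morphism underlying the inverse of the right unitor. -/
def rightUnitorInv (X : ModuleCat.{u} A) : X ⟶ T.obj X S.unit :=
  T.η X S.unit ≫ S.i.app (T.obj X S.unit)

@[simp]
theorem rightUnitorInv_apply (X : ModuleCat.{u} A) (x : (forgetToBase k A).obj X) :
    baseMap k (T.rightUnitorInv X) x = T.μ X S.unit (x ⊗ₜ Φ.unitMap 1) := by
  simp [rightUnitorInv, Φ.baseMap_i]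

/-- The comparison isomorphism. -/
abbrev μIso (X Y : ModuleCat.{u} A) :
    (forgetToBase k A).obj X ⊗ (forgetToBase k A).obj Y ≅ (forgetToBase k A).obj (T.obj X Y) :=
  (T.μ X Y).toModuleIso

/-- The skew-closed data yield a morphism in one direction only. Its underlying map is the
associator of `k`-modules up to `μ`, so it is invertible because the forgetful functor reflects
isomorphisms; the equation is also what is needed to induce coherence. The unitors are treated in
the same way. -/
theorem map_assocHom (X Y Z : ModuleCat.{u} A) :
    (forgetToBase k A).map (T.assocHom X Y Z) =
      (((T.μIso _ _).symm ≪≫ ((T.μIso _ _).symm ⊗ᵢ .refl _))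
        ≪≫ α_ ((forgetToBase k A).obj X) ((forgetToBase k A).obj Y) ((forgetToBase k A).obj Z)
        ≪≫ ((.refl _ ⊗ᵢ T.μIso _ _) ≪≫ T.μIso _ _)).hom := by
  rw [← cancel_epi (T.μIso _ _).hom,
    ← cancel_epi ((T.μIso X Y).hom ▷ (forgetToBase k A).obj Z)]
  simp only [Iso.trans_hom, Iso.symm_hom, tensorIso_hom, Iso.refl_hom, tensorHom_id,
    id_tensorHom, Category.assoc, Iso.hom_inv_id_assoc, hom_inv_whiskerRight_assoc]
  refine ModuleCat.hom_ext (TensorProduct.ext_threefold fun x y z => ?_)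
  exact T.assocHom_μ X Y Z x y z

instance (X Y Z : ModuleCat.{u} A) : IsIso (T.assocHom X Y Z) := by
  have : IsIso ((forgetToBase k A).map (T.assocHom X Y Z)) := by
    rw [map_assocHom]
    infer_instance
  exact isIso_of_reflects_iso _ (forgetToBase k A)

/-- The comparison isomorphism of unit objects. -/
abbrev εIso (hΦ : Φ.IsStrong) :
    𝟙_ (ModuleCat.{u} k) ≅ (forgetToBase k A).obj S.unit :=
  letI : IsIso (X := 𝟙_ (ModuleCat.{u} k)) Φ.F₀ := hΦ.isIso_F₀
  asIso (X := 𝟙_ (ModuleCat.{u} k)) Φ.F₀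

theorem map_leftUnitorHom (hΦ : Φ.IsStrong) (X : ModuleCat.{u} A) :
    (forgetToBase k A).map (T.leftUnitorHom X) =
      (((T.μIso _ _).symm ≪≫ ((εIso hΦ).symm ⊗ᵢ .refl _)) ≪≫
        λ_ ((forgetToBase k A).obj X)).hom := by
  rw [← cancel_epi (T.μIso _ _).hom,
    ← cancel_epi ((εIso hΦ).hom ▷ (forgetToBase k A).obj X)]
  simp only [Iso.trans_hom, Iso.symm_hom, tensorIso_hom, Iso.refl_hom, tensorHom_id,
    Category.assoc, Iso.hom_inv_id_assoc, hom_inv_whiskerRight_assoc]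
  refine ModuleCat.hom_ext (TensorProduct.ext' fun r x => ?_)
  exact T.leftUnitorHom_μ X r x

theorem isIso_leftUnitorHom (hΦ : Φ.IsStrong) (X : ModuleCat.{u} A) :
    IsIso (T.leftUnitorHom X) := by
  have : IsIso ((forgetToBase k A).map (T.leftUnitorHom X)) := by
    rw [T.map_leftUnitorHom hΦ]
    infer_instance
  exact isIso_of_reflects_iso _ (forgetToBase k A)

theorem map_rightUnitorInv (hΦ : Φ.IsStrong) (X : ModuleCat.{u} A) :
    (forgetToBase k A).map (T.rightUnitorInv X) =
      (((T.μIso _ _).symm ≪≫ (.refl _ ⊗ᵢ (εIso hΦ).symm)) ≪≫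
        ρ_ ((forgetToBase k A).obj X)).inv := by
  simp only [Iso.trans_inv, Iso.symm_inv, tensorIso_inv, Iso.refl_inv, id_tensorHom]
  refine ModuleCat.hom_ext (LinearMap.ext fun x => ?_)
  exact T.rightUnitorInv_apply X x

theorem isIso_rightUnitorInv (hΦ : Φ.IsStrong) (X : ModuleCat.{u} A) :
    IsIso (T.rightUnitorInv X) := by
  have : IsIso ((forgetToBase k A).map (T.rightUnitorInv X)) := by
    rw [T.map_rightUnitorInv hΦ]
    infer_instance
  exact isIso_of_reflects_iso _ (forgetToBase k A)

/-- The tensor product, the unit and the structure isomorphisms. -/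
@[reducible]
def monoidalStruct (hΦ : Φ.IsStrong) : MonoidalCategoryStruct (ModuleCat.{u} A) where
  tensorObj := T.obj
  tensorUnit := S.unit
  whiskerLeft X _ Y' g := T.lift (T.η X Y' ≫ ihMap S.ihom g (𝟙 (T.obj X Y')))
  whiskerRight {_ X'} f Y := T.lift (f ≫ T.η X' Y)
  tensorHom {_ X' _ Y'} f g := T.lift (f ≫ T.η X' Y' ≫ ihMap S.ihom g (𝟙 (T.obj X' Y')))
  associator X Y Z := asIso (T.assocHom X Y Z)
  leftUnitor X :=
    letI := T.isIso_leftUnitorHom hΦ X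
    asIso (T.leftUnitorHom X)
  rightUnitor X :=
    letI := T.isIso_rightUnitorInv hΦ X
    (asIso (T.rightUnitorInv X)).symm

/-- The forgetful functor preserves the tensor product and the structure isomorphisms. -/
@[reducible]
def inducingData (hΦ : Φ.IsStrong) :
    letI := T.monoidalStruct hΦ
    Monoidal.InducingFunctorData (forgetToBase k A) :=
  letI := T.monoidalStruct hΦ
  { μIso := T.μIso
    εIso := εIso hΦ
    whiskerLeft_eq := fun X Y Y' g => by
      rw [← cancel_epi (T.μIso _ _).hom, Iso.hom_inv_id_assoc]
      refine ModuleCat.hom_ext (TensorProduct.ext' fun x y => ?_)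
      exact (T.lift_μ _ x y).trans ((Φ.val_ihMap _ _ _ _).trans (T.val_η X Y' x (baseMap k g y)))
    whiskerRight_eq := fun {X X'} f Y => by
      rw [← cancel_epi (T.μIso _ _).hom, Iso.hom_inv_id_assoc]
      refine ModuleCat.hom_ext (TensorProduct.ext' fun x y => ?_)
      exact (T.lift_μ _ x y).trans (T.val_η X' Y (baseMap k f x) y)
    tensorHom_eq := fun {X X' Y Y'} f g => by
      rw [← cancel_epi (T.μIso _ _).hom, Iso.hom_inv_id_assoc]
      refine ModuleCat.hom_ext (TensorProduct.ext' fun x y => ?_)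
      exact (T.lift_μ _ x y).trans ((Φ.val_ihMap _ _ _ _).trans
        (T.val_η X' Y' (baseMap k f x) (baseMap k g y)))
    associator_eq := T.map_assocHom
    leftUnitor_eq := T.map_leftUnitorHom hΦ
    rightUnitor_eq := fun X => by
      have h : (forgetToBase k A).mapIso (ρ_ X).symm =
        (((T.μIso _ _).symm ≪≫ (.refl _ ⊗ᵢ (εIso hΦ).symm)) ≪≫
          ρ_ ((forgetToBase k A).obj X)).symm := Iso.ext (T.map_rightUnitorInv hΦ X)
      exact congrArg Iso.inv h }

/-- The monoidal structure on `A`-modules. -/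
@[reducible]
def monoidal (hΦ : Φ.IsStrong) : MonoidalCategory (ModuleCat.{u} A) :=
  letI := T.monoidalStruct hΦ
  Monoidal.induced (forgetToBase k A) (T.inducingData hΦ)

/-- The tensor-hom adjunction. -/
def adj (hΦ : Φ.IsStrong) (Y : ModuleCat.{u} A) :
    letI := T.monoidal hΦ
    tensorRight Y ⊣ S.ihom.obj (op Y) :=
  letI := T.monoidal hΦ
  Adjunction.mkOfHomEquiv
    { homEquiv := fun X Z => T.homEquiv hΦ X Y Z
      homEquiv_naturality_left_symm := fun {X X' Z} f g => T.hom_ext fun x y => by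
        refine (T.lift_μ _ x y).trans ?_
        refine Eq.trans ?_ (congrArg (baseMap k (T.lift g)) (T.lift_μ (f ≫ T.η X' Y) x y)).symm
        simp
      homEquiv_naturality_right := fun {X Z Z'} f g => hΦ.hom_ext fun x y => by
        refine (T.val_homEquiv hΦ _ x y).trans ?_
        refine Eq.trans ?_ (Φ.val_ihom_map g _ y).symm
        exact congrArg (baseMap k g) (T.val_homEquiv hΦ f x y).symm }

theorem adj_homEquiv (hΦ : Φ.IsStrong) (X Y Z : ModuleCat.{u} A) :
    letI := T.monoidal hΦ
    (T.adj hΦ Y).homEquiv X Z = T.homEquiv hΦ X Y Z := by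
  simp [adj]

theorem adj_unit (hΦ : Φ.IsStrong) (X Y : ModuleCat.{u} A) :
    letI := T.monoidal hΦ
    (T.adj hΦ Y).unit.app X = T.η X Y := by
  refine hΦ.hom_ext fun x y => ?_
  exact (T.val_homEquiv hΦ (𝟙 _) x y).trans (T.val_η X Y x y).symm

/-- The closed monoidal structure on `A`-modules. -/
def rightClosedMonoidal (hΦ : Φ.IsStrong) : RightClosedMonoidal S :=
  letI := T.monoidal hΦ
  { monoidal := T.monoidal hΦ
    adj := T.adj hΦ
    adj_natural := fun {X X'} f Y Z g => hΦ.hom_ext fun y x => by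
      rw [T.adj_homEquiv, T.adj_homEquiv]
      refine (T.val_homEquiv hΦ _ y x).trans ?_
      refine (congrArg (baseMap k g)
        (T.lift_μ (T.η Y X' ≫ ihMap S.ihom f (𝟙 (T.obj Y X'))) y x)).trans ?_
      refine (congrArg (baseMap k g) (Φ.val_ihMap f (𝟙 (T.obj Y X')) _ x)).trans ?_
      refine (congrArg (baseMap k g) (T.val_η Y X' y (baseMap k f x))).trans ?_
      refine Eq.trans ?_ (Φ.val_ihMap f (𝟙 Z) _ x).symm
      exact (T.val_homEquiv hΦ g y (baseMap k f x)).symm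
    unit_eq := rfl
    leftUnitor_dual := fun X => hΦ.hom_ext fun r x => by
      rw [T.adj_unit]
      obtain ⟨r, rfl⟩ := hΦ.unitMap_bijective.2 r
      refine (Φ.val_ihMap (𝟙 X) (T.leftUnitorHom X) _ x).trans ?_
      refine (congrArg _ (T.val_η S.unit X (Φ.unitMap r) x)).trans ?_
      exact (T.leftUnitorHom_μ X r x).trans (Φ.val_j X r x).symm
    rightUnitor_dual := fun X => by
      rw [T.adj_unit]
      refine baseMap_injective k fun x => ?_
      refine (T.rightUnitorInv_apply X x).trans ?_
      refine Eq.trans ?_ (Φ.baseMap_i _ _).symm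
      refine Eq.trans ?_ (Φ.val_ihMap (𝟙 S.unit) (𝟙 _) _ _).symm
      exact (T.val_η X S.unit x (Φ.unitMap 1)).symm
    -- Evaluated at `x`, `y`, `z`, both sides are `μ (x ⊗ μ (y ⊗ z))`.
    associator_dual := fun X Y Z => by
      rw [T.adj_unit, T.adj_unit, T.adj_unit, T.adj_unit]
      refine hΦ.hom_ext fun x y => hΦ.val_ext fun z => ?_
      refine (congrArg (fun p => Φ.val _ _ p z) ((Φ.val_ihMap _ _ _ y).trans
        (congrArg _ (Φ.val_ihMap _ _ _ y)))).trans ?_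
      refine (Φ.val_ihMap _ _ _ z).trans ?_
      refine (congrArg _ (congrArg (fun p => Φ.val _ _ (baseMap k (T.η (T.obj X Y) Z) p) z)
        (T.val_η X Y x y))).trans ?_
      refine (congrArg _ (T.val_η (T.obj X Y) Z (T.μ X Y (x ⊗ₜ y)) z)).trans ?_
      refine (T.assocHom_μ X Y Z x y z).trans ?_
      refine Eq.trans ?_ (congrArg (fun p => Φ.val _ _ p z) (Φ.val_ihMap _ _ _ y)).symm
      refine Eq.trans ?_ (Φ.val_Γ _ _ _ _ _ z).symm
      refine Eq.trans ?_ (congrArg _ (T.val_η Y Z y z)).symm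
      exact (T.val_η X (T.obj Y Z) x _).symm }

/-- The monoidal structure was built from invertibility of the comparison maps alone. Strictness
enters only here, and compatibility with the adjunction units is `val_η`. -/
theorem isStrictClosedMonoidal (hΦ : Φ.IsStrict) (hμ : ∀ X Y, IsIdentity (T.μIso X Y).hom) :
    IsStrictClosedMonoidal (T.rightClosedMonoidal hΦ.isStrong) (baseClosedMonoidal k)
      (forgetToBase k A) := by
  let _ := T.monoidalStruct hΦ.isStrong
  let _ := T.monoidal hΦ.isStrong
  refine ⟨Φ, (Monoidal.fromInducedCoreMonoidal (forgetToBase k A)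
    (T.inducingData hΦ.isStrong)).toLaxMonoidal, hΦ, hΦ.F₀_id, hμ, fun X Y => ?_⟩
  change (forgetToBase k A).map ((T.adj hΦ.isStrong Y).unit.app X) ≫ _ = _
  rw [T.adj_unit]
  exact ModuleCat.hom_ext (LinearMap.ext fun x => LinearMap.ext fun y => T.val_η X Y x y)

end ClosedFunctor.TensorLift

/-! ### Normality of closed monoidal categories -/

section InternalHom

variable {C : Type u} [Category.{v} C] (H : Cᵒᵖ ⥤ C ⥤ C)

@[simp]
theorem ihMap_id (X Y : C) : ihMap H (𝟙 X) (𝟙 Y) = 𝟙 (ihObj H X Y) := by simp [ihMap]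

theorem ihMap_comp {X X' X'' Y Y' Y'' : C} (f : X' ⟶ X) (f' : X'' ⟶ X') (g : Y ⟶ Y')
    (g' : Y' ⟶ Y'') : ihMap H f g ≫ ihMap H f' g' = ihMap H (f' ≫ f) (g ≫ g') := by
  simp [ihMap]

theorem ihMap_comp_assoc {X X' X'' Y Y' Y'' W : C} (f : X' ⟶ X) (f' : X'' ⟶ X') (g : Y ⟶ Y')
    (g' : Y' ⟶ Y'') (h : ihObj H X'' Y'' ⟶ W) :
    ihMap H f g ≫ ihMap H f' g' ≫ h = ihMap H (f' ≫ f) (g ≫ g') ≫ h := by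
  rw [← ihMap_comp, Category.assoc (ihMap H f g)]

theorem ihom_map_eq_ihMap (X : C) {Y Y' : C} (g : Y ⟶ Y') :
    (H.obj (op X)).map g = ihMap H (𝟙 X) g := by simp [ihMap]

end InternalHom

namespace SkewClosed

variable {C : Type u} [Category.{v} C] (S : SkewClosed C)

/-- A morphism `η : X ⟶ [Y, P]` is universal if `P` represents `C(X, [Y, -])` through `η`. -/
def IsUniversal {X Y P : C} (η : X ⟶ ihObj S.ihom Y P) : Prop :=
  ∀ V : C, Function.Bijective fun h : P ⟶ V => η ≫ ihMap S.ihom (𝟙 Y) h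

/-- The morphism `[P, Z] ⟶ [X, [Y, Z]]` induced by `η : X ⟶ [Y, P]`. -/
def uncurriedComp {X Y P : C} (η : X ⟶ ihObj S.ihom Y P) (Z : C) :
    ihObj S.ihom P Z ⟶ ihObj S.ihom X (ihObj S.ihom Y Z) :=
  S.Γ Y P Z ≫ ihMap S.ihom η (𝟙 (ihObj S.ihom Y Z))

variable {S}

theorem Γ_natural_assoc (X : C) {Y Y' Z Z' W : C} (f : Y' ⟶ Y) (g : Z ⟶ Z')
    (h : ihObj S.ihom (ihObj S.ihom X Y') (ihObj S.ihom X Z') ⟶ W) :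
    ihMap S.ihom f g ≫ S.Γ X Y' Z' ≫ h =
      S.Γ X Y Z ≫ ihMap S.ihom (ihMap S.ihom (𝟙 X) f) (ihMap S.ihom (𝟙 X) g) ≫ h := by
  rw [← Category.assoc (ihMap S.ihom f g), S.Γ_natural, Category.assoc (S.Γ X Y Z)]

/-- The coend defining associative normality, computed by the co-Yoneda lemma. -/
theorem IsUniversal.bijective_mk {X Y P : C} {η : X ⟶ ihObj S.ihom Y P} (hη : S.IsUniversal η)
    (U Z : C) : Function.Bijective fun f : U ⟶ ihObj S.ihom P Z =>
      (Quot.mk _ ⟨P, f, η⟩ : S.Coend U X Y Z) := by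
  choose d hd using fun V => (hη V).2
  have hd' : ∀ V (g : X ⟶ ihObj S.ihom Y V), η ≫ ihMap S.ihom (𝟙 Y) (d V g) = g := hd
  constructor
  -- A retraction: `d V g` is the factorization of `g` through `η`, and gluing along it moves every
  -- pair to one with second component `η`.
  · let r : S.Coend U X Y Z → (U ⟶ ihObj S.ihom P Z) :=
      Quot.lift (fun p => p.2.1 ≫ ihMap S.ihom (d _ p.2.2) (𝟙 Z)) (by
        rintro _ _ ⟨h, f, g⟩
        have e : d _ g ≫ h = d _ (g ≫ ihMap S.ihom (𝟙 Y) h) := (hη _).1 (by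
          change η ≫ ihMap S.ihom (𝟙 Y) (d _ g ≫ h) = η ≫ ihMap S.ihom (𝟙 Y) (d _ _)
          rw [hd', ← Category.comp_id (𝟙 Y), ← ihMap_comp, ← Category.assoc, hd',
            Category.comp_id])
        change (f ≫ ihMap S.ihom h (𝟙 Z)) ≫ ihMap S.ihom (d _ g) (𝟙 Z) =
          f ≫ ihMap S.ihom (d _ (g ≫ ihMap S.ihom (𝟙 Y) h)) (𝟙 Z)
        rw [Category.assoc, ihMap_comp, e, Category.comp_id])
    have e : d P η = 𝟙 P := (hη P).1 (by
      change η ≫ ihMap S.ihom (𝟙 Y) (d _ η) = η ≫ ihMap S.ihom (𝟙 Y) (𝟙 P)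
      rw [hd', ihMap_id, Category.comp_id])
    refine Function.LeftInverse.injective (g := r) fun f => ?_
    change f ≫ ihMap S.ihom (d P η) (𝟙 Z) = f
    rw [e, ihMap_id, Category.comp_id]
  · rintro ⟨V, f, g⟩
    refine ⟨f ≫ ihMap S.ihom (d V g) (𝟙 Z), ?_⟩
    refine (Quot.sound (CoendRel.glue (d V g) f η)).trans ?_
    rw [hd']

theorem IsUniversal.bijective_Γhat_iff {X Y P : C} {η : X ⟶ ihObj S.ihom Y P}
    (hη : S.IsUniversal η) (U Z : C) :
    Function.Bijective (S.Γhat U X Y Z) ↔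
      Function.Bijective fun f : U ⟶ ihObj S.ihom P Z => f ≫ S.uncurriedComp η Z :=
  (Function.Bijective.of_comp_iff (S.Γhat U X Y Z) (hη.bijective_mk U Z)).symm

end SkewClosed

namespace RightClosedMonoidal

variable {C : Type u} [Category.{v} C] {S : SkewClosed C} (M : RightClosedMonoidal S)

/-- The coevaluation `X ⟶ [Y, X ⊗ Y]`. -/
def coev (X Y : C) : letI := M.monoidal; X ⟶ ihObj S.ihom Y (X ⊗ Y) :=
  (M.adj Y).unit.app X

theorem homEquiv_eq (X Y Z : C) (f : letI := M.monoidal; X ⊗ Y ⟶ Z) :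
    letI := M.monoidal
    (M.adj Y).homEquiv X Z f = M.coev X Y ≫ ihMap S.ihom (𝟙 Y) f := by
  let _ := M.monoidal
  rw [Adjunction.homEquiv_unit, ihom_map_eq_ihMap]
  rfl

theorem coev_leftUnitor (X : C) :
    letI := M.monoidal
    M.coev (𝟙_ C) X ≫ ihMap S.ihom (𝟙 X) (λ_ X).hom = eqToHom M.unit_eq ≫ S.j X :=
  M.leftUnitor_dual X

theorem rightUnitor_inv (X : C) :
    letI := M.monoidal
    (ρ_ X).inv = M.coev X (𝟙_ C) ≫ ihMap S.ihom (eqToHom M.unit_eq.symm) (𝟙 (X ⊗ 𝟙_ C)) ≫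
        S.i.app (X ⊗ 𝟙_ C) :=
  M.rightUnitor_dual X

theorem coev_associator (X Y Z : C) :
    letI := M.monoidal
    M.coev X Y ≫ ihMap S.ihom (𝟙 Y) (M.coev (X ⊗ Y) Z) ≫
        ihMap S.ihom (𝟙 Y) (ihMap S.ihom (𝟙 Z) (α_ X Y Z).hom) =
      M.coev X (Y ⊗ Z) ≫ S.uncurriedComp (M.coev Y Z) (X ⊗ (Y ⊗ Z)) :=
  M.associator_dual X Y Z

/-- By the duality of `j` and the left unitor, the map is the composite `C(X, Y) ≅ C(1 ⊗ X, Y) ≅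
C(1, [X, Y])`. -/
theorem leftNormal (M : RightClosedMonoidal S) : S.LeftNormal := by
  let _ := M.monoidal
  intro X Y
  have h : (fun f : X ⟶ Y => S.j Y ≫ ihMap S.ihom f (𝟙 Y)) =
      (eqToIso M.unit_eq).homFromEquiv ∘ (M.adj X).homEquiv (𝟙_ C) Y ∘
        (λ_ X).symm.homFromEquiv := by
    funext f
    change _ = eqToHom M.unit_eq.symm ≫ (M.adj X).homEquiv (𝟙_ C) Y ((λ_ X).hom ≫ f)
    rw [← leftUnitor_naturality, M.adj_natural, M.homEquiv_eq, M.coev_leftUnitor,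
      Category.assoc (eqToHom _), eqToHom_trans_assoc, eqToHom_refl, Category.id_comp]
  rw [h]
  exact (Equiv.bijective _).comp ((Equiv.bijective _).comp (Equiv.bijective _))

/-- By Yoneda: under `C(Y ⊗ 1, X) ≅ C(Y, [1, X])`, composing with `i` becomes precomposing with the
inverse right unitor of `Y`. -/
theorem rightNormal (M : RightClosedMonoidal S) : S.RightNormal := by
  let _ := M.monoidal
  have (X : C) : IsIso (S.i.app X) := by
    have : IsIso (ihMap S.ihom (eqToHom M.unit_eq.symm) (𝟙 X)) := by
      unfold ihMap
      infer_instance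
    refine (isIso_comp_left_iff (ihMap S.ihom (eqToHom M.unit_eq.symm) (𝟙 X)) _).1 ?_
    refine isIso_of_yoneda_map_bijective _ fun Y => ?_
    rw [← Function.Bijective.of_comp_iff _ ((M.adj (𝟙_ C)).homEquiv Y X).bijective]
    have h : (fun g => g ≫ ihMap S.ihom (eqToHom M.unit_eq.symm) (𝟙 X) ≫ S.i.app X) ∘
        (M.adj (𝟙_ C)).homEquiv Y X = (ρ_ Y).homFromEquiv := by
      funext f
      change (M.adj (𝟙_ C)).homEquiv Y X f ≫ _ = (ρ_ Y).inv ≫ f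
      have hi : ihMap S.ihom (𝟙 S.unit) f ≫ S.i.app X = S.i.app (Y ⊗ 𝟙_ C) ≫ f := by
        rw [← ihom_map_eq_ihMap]
        exact S.i.naturality f
      rw [M.homEquiv_eq, M.rightUnitor_inv, Category.assoc (M.coev Y _),
        Category.assoc (M.coev Y _), Category.assoc (ihMap _ _ _), ← hi, ihMap_comp_assoc,
        ihMap_comp_assoc, Category.comp_id, Category.id_comp, Category.id_comp, Category.comp_id]
    rw [h]
    exact Equiv.bijective _
  exact NatIso.isIso_of_isIso_app S.i

theorem isUniversal_coev (M : RightClosedMonoidal S) (X Y : C) :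
    S.IsUniversal (M.coev X Y) := by
  let _ := M.monoidal
  intro V
  have h : (fun h => M.coev X Y ≫ ihMap S.ihom (𝟙 Y) h) =
    (M.adj Y).homEquiv X V := funext fun h => (M.homEquiv_eq X Y V h).symm
  exact h ▸ ((M.adj Y).homEquiv X V).bijective

/-- For `f` an identity this is the duality of `Γ` and the associator; naturality of `Γ` gives the
general case. -/
theorem homEquiv_comp_uncurriedComp (U X Y Z : C) (f : letI := M.monoidal; U ⊗ (X ⊗ Y) ⟶ Z) :
    letI := M.monoidal
    (M.adj (X ⊗ Y)).homEquiv U Z f ≫ S.uncurriedComp (M.coev X Y) Z =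
      (M.adj X).homEquiv U _ ((M.adj Y).homEquiv (U ⊗ X) Z ((α_ U X Y).hom ≫ f)) := by
  let _ := M.monoidal
  have hΓ : ihMap S.ihom (𝟙 (X ⊗ Y)) f ≫ S.uncurriedComp (M.coev X Y) Z =
      S.uncurriedComp (M.coev X Y) (U ⊗ (X ⊗ Y)) ≫
        ihMap S.ihom (𝟙 X) (ihMap S.ihom (𝟙 Y) f) := by
    unfold SkewClosed.uncurriedComp
    rw [SkewClosed.Γ_natural_assoc, ihMap_comp, Category.assoc (S.Γ _ _ _), ihMap_comp,
      ihMap_id, Category.comp_id, Category.comp_id, Category.id_comp, Category.id_comp]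
  rw [M.homEquiv_eq, M.homEquiv_eq, M.homEquiv_eq, Category.assoc (M.coev _ _), hΓ,
    ← Category.assoc (M.coev _ _), ← M.coev_associator, Category.assoc (M.coev U X),
    Category.assoc (ihMap _ _ _), ihMap_comp, ihMap_comp, ihMap_comp,
    Category.id_comp, Category.id_comp, Category.id_comp]

/-- The coevaluation is universal, so the coend is `C(U, [X ⊗ Y, Z])`, and what remains is
precomposition with the associator between iterated adjunctions. -/
theorem assocNormal (M : RightClosedMonoidal S) : S.AssocNormal := by
  let _ := M.monoidal
  intro U X Y Z
  rw [(M.isUniversal_coev X Y).bijective_Γhat_iff,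
    ← Function.Bijective.of_comp_iff _ ((M.adj (X ⊗ Y)).homEquiv U Z).bijective]
  have h : (fun f => f ≫ S.uncurriedComp (M.coev X Y) Z) ∘
      (M.adj (X ⊗ Y)).homEquiv U Z = (M.adj X).homEquiv U _ ∘
        (M.adj Y).homEquiv (U ⊗ X) Z ∘ (α_ U X Y).symm.homFromEquiv :=
    funext fun f => M.homEquiv_comp_uncurriedComp U X Y Z f
  rw [h]
  exact (Equiv.bijective _).comp ((Equiv.bijective _).comp (Equiv.bijective _))

theorem isNormal (M : RightClosedMonoidal S) : S.IsNormal :=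
  ⟨M.leftNormal, M.rightNormal, M.assocNormal⟩

end RightClosedMonoidal

/-! ### Existence of lifted tensor products and of right adjoints -/

section Limits

open CategoryTheory.Limits

variable {k A : Type u} [CommRing k] [Ring A] [Algebra k A]

instance : PreservesLimits (forgetToBase k A) := by
  have : PreservesLimits (forgetToBase k A ⋙ forget₂ (ModuleCat.{u} k) AddCommGrpCat.{u}) :=
    inferInstanceAs (PreservesLimits (forget₂ (ModuleCat.{u} A) AddCommGrpCat.{u}))
  have : ReflectsLimits (forget₂ (ModuleCat.{u} k) AddCommGrpCat.{u}) :=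
    reflectsLimits_of_reflectsIsomorphisms
  exact preservesLimits_of_reflects_of_preserves _ (forget₂ (ModuleCat.{u} k) AddCommGrpCat.{u})

/-- If a strictly monoidal functor to `k`-modules exists, the tensor products have right adjoints
on both sides. -/
theorem RightClosedMonoidal.isBiclosed {S : SkewClosed (ModuleCat.{u} A)}
    (M : RightClosedMonoidal S)
    (h : IsStrictClosedMonoidal M (baseClosedMonoidal k) (forgetToBase k A)) :
    M.IsBiclosed := by
  let _ := M.monoidal
  let _ := (baseClosedMonoidal k).monoidal
  obtain ⟨Φ, L, -, -, hμ, -⟩ := h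
  intro X
  have hiso (Y : ModuleCat.{u} A) : IsIso (L.μ X Y) := by
    obtain ⟨e, he⟩ := hμ X Y
    rw [he]
    infer_instance
  -- `X ⊗ -` lifts the cocontinuous functor `X ⊗_k -`, and the forgetful functor reflects colimits.
  -- So `X ⊗ -` is cocontinuous, and the special adjoint functor theorem applies because `A`-modules
  -- have a separator.
  have e : tensorLeft X ⋙ forgetToBase k A ≅
      forgetToBase k A ⋙ tensorLeft ((forgetToBase k A).obj X) :=
    (NatIso.ofComponents (fun Y => @asIso _ _ _ _ (L.μ X Y) (hiso Y))
      (fun f => L.μ_natural_right X f)).symm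
  have : PreservesColimits (tensorLeft ((forgetToBase k A).obj X)) :=
    inferInstanceAs (PreservesColimits
      (@tensorLeft (ModuleCat.{u} k) _ ModuleCat.monoidalCategory ((forgetToBase k A).obj X)))
  have : PreservesColimits (tensorLeft X ⋙ forgetToBase k A) :=
    preservesColimits_of_natIso e.symm
  have : ReflectsColimits (forgetToBase k A) := reflectsColimits_of_reflectsIsomorphisms
  have : PreservesColimits (tensorLeft X) :=
    preservesColimits_of_reflects_of_preserves _ (forgetToBase k A)
  exact isLeftAdjoint_of_preservesColimits_of_isSeparating.{u} (isSeparator_separator _) _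

/-- `[Y, -]` lifts the limit-preserving functor `Hom_k(Y, -)` along a functor that preserves and
reflects limits; a coseparator then provides the left adjoint. -/
theorem ClosedFunctor.IsStrong.ihom_isRightAdjoint {S : SkewClosed (ModuleCat.{u} A)}
    {Φ : ClosedFunctor S (baseSkewClosed k) (forgetToBase k A)} (hΦ : Φ.IsStrong)
    (Y : ModuleCat.{u} A) : (S.ihom.obj (op Y)).IsRightAdjoint := by
  let _ := (baseClosedMonoidal k).monoidal
  have e : S.ihom.obj (op Y) ⋙ forgetToBase k A ≅
      forgetToBase k A ⋙ (baseIhom k).obj (op ((forgetToBase k A).obj Y)) :=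
    NatIso.ofComponents (fun Z => @asIso _ _ _ _ (Φ.F₂ Y Z) (hΦ.isIso_F₂ Y Z)) (fun {Z Z'} g =>
      ModuleCat.hom_ext (LinearMap.ext fun p => LinearMap.ext fun y => Φ.val_ihom_map g p y))
  have : PreservesLimits ((baseIhom k).obj (op ((forgetToBase k A).obj Y))) :=
    ((baseClosedMonoidal k).adj _).rightAdjoint_preservesLimits
  have : PreservesLimits (S.ihom.obj (op Y) ⋙ forgetToBase k A) :=
    preservesLimits_of_natIso e.symm
  have : ReflectsLimits (forgetToBase k A) := reflectsLimits_of_reflectsIsomorphisms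
  have : PreservesLimits (S.ihom.obj (op Y)) :=
    preservesLimits_of_reflects_of_preserves _ (forgetToBase k A)
  exact isRightAdjoint_of_preservesLimits_of_isCoseparating.{u} (isCoseparator_coseparator _) _

end Limits

/-! ### Transport of module structures, for strictness on the nose -/

section Transport

variable {k A : Type u} [CommRing k] [Ring A] [Algebra k A]

/-- A linear map that fixes every element of the common carrier forces the two scalar
multiplications to agree, so the two objects are equal. -/
theorem isIdentity_of_apply_eq {W : Type u} [AddCommGroup W] {m m' : Module k W}
    (f : @ModuleCat.of k _ W _ m ⟶ @ModuleCat.of k _ W _ m')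
    (hf : ∀ w : W, (f.hom : W → W) w = w) : IsIdentity f := by
  obtain rfl : m = m' := by
    have map_smul {M N : ModuleCat.{u} k} (g : M ⟶ N) (r : k) (x : M) :
        g.hom (r • x) = r • g.hom x := g.hom.map_smul r x
    exact Module.ext' _ _ fun r w => ((hf _).symm.trans (map_smul f r w)).trans
      (congrArg (@SMul.smul k W m'.toSMul r) (hf w))
  exact ⟨rfl, ModuleCat.hom_ext (LinearMap.ext hf)⟩

variable {W : Type u} [AddCommGroup W] [Module k W] {P : ModuleCat.{u} A}
  (e : W ≃ₗ[k] (forgetToBase k A).obj P)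

/-- The `A`-module with carrier `W` obtained by transport of structure. -/
abbrev transportObj : ModuleCat.{u} A :=
  letI : Module A W := e.toAddEquiv.module A
  ModuleCat.of A W

/-- The identity map, as a `k`-linear equivalence. -/
def transportBaseEquiv : W ≃ₗ[k] (forgetToBase k A).obj (transportObj e) where
  toFun w := w
  invFun w := w
  left_inv _ := rfl
  right_inv _ := rfl
  map_add' _ _ := rfl
  map_smul' r w := by
    change r • w = e.symm (algebraMap k A r • e w)
    refine e.injective ?_
    rw [e.apply_symm_apply, map_smul]
    rfl

theorem transportBaseEquiv_isIdentity :
    IsIdentity (transportBaseEquiv e).toModuleIso.hom :=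
  isIdentity_of_apply_eq _ fun _ => rfl

/-- The structure transport, as an isomorphism of `A`-modules. -/
def transportIso : transportObj e ≅ P where
  hom := homOfBase k (X := transportObj e) (Y := P)
    (e.toLinearMap ∘ₗ (transportBaseEquiv e).symm.toLinearMap)
    (fun a w => e.apply_symm_apply (a • e w))
  inv := homOfBase k (X := P) (Y := transportObj e)
    ((transportBaseEquiv e).toLinearMap ∘ₗ e.symm.toLinearMap)
    (fun a p => by
      change e.symm (a • p) = e.symm (a • e (e.symm p))
      rw [e.apply_symm_apply])
  hom_inv_id := baseMap_injective k fun w => e.symm_apply_apply w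
  inv_hom_id := baseMap_injective k fun p => e.apply_symm_apply p

end Transport

/-! ### Lifted tensor products from normality -/

namespace ClosedFunctor

variable {k A : Type u} [CommRing k] [Ring A] [Algebra k A]
variable {S : SkewClosed (ModuleCat.{u} A)}
variable {Φ : ClosedFunctor S (baseSkewClosed k) (forgetToBase k A)}

/-- A linear functional on `A` taking the value `1` at `1`, obtained from the unit object. -/
theorem IsStrong.exists_functional (hΦ : Φ.IsStrong) : ∃ e : A →ₗ[k] k, e 1 = 1 := by
  let u := LinearEquiv.ofBijective Φ.unitMap hΦ.unitMap_bijective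
  refine ⟨u.symm.toLinearMap ∘ₗ
    (LinearMap.toSpanSingleton A ((forgetToBase k A).obj S.unit) (u 1)).restrictScalars k, ?_⟩
  change u.symm ((1 : A) • u 1) = 1
  rw [one_smul, u.symm_apply_apply]

variable {X Y P : ModuleCat.{u} A} {η : X ⟶ ihObj S.ihom Y P}

theorem val_uncurriedComp (Z : ModuleCat.{u} A) (p : (forgetToBase k A).obj (ihObj S.ihom P Z))
    (x : (forgetToBase k A).obj X) (y : (forgetToBase k A).obj Y) :
    Φ.val Y Z (Φ.val X (ihObj S.ihom Y Z) (baseMap k (S.uncurriedComp η Z) p) x) y =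
      Φ.val P Z p (Φ.val Y P (baseMap k η x) y) := by
  simp [SkewClosed.uncurriedComp]

variable (Φ) in
/-- The linear map `X ⊗ Y → P` underlying a morphism `X ⟶ [Y, P]`. -/
def tensorMap (η : X ⟶ ihObj S.ihom Y P) :
    (forgetToBase k A).obj X ⊗[k] (forgetToBase k A).obj Y →ₗ[k] (forgetToBase k A).obj P :=
  TensorProduct.lift (Φ.val Y P ∘ₗ baseMap k η)

/-- With `η` universal, (N3) for all `U` and Yoneda make `[P, Z] ⟶ [X, [Y, Z]]` an isomorphism.
Through `val` and currying, its underlying map is precomposition with `tensorMap`. -/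
theorem IsStrong.bijective_comp_tensorMap (hΦ : Φ.IsStrong) (hS : S.AssocNormal)
    (hη : S.IsUniversal η) (Z : ModuleCat.{u} A) :
    Function.Bijective fun h : (forgetToBase k A).obj P →ₗ[k] (forgetToBase k A).obj Z =>
      h ∘ₗ Φ.tensorMap η := by
  have hc : IsIso (S.uncurriedComp η Z) :=
    isIso_of_yoneda_map_bijective _ fun U => (hη.bijective_Γhat_iff U Z).1 (hS U X Y Z)
  have hb : Function.Bijective (baseMap k (S.uncurriedComp η Z)) :=
    ConcreteCategory.bijective_of_isIso (S.uncurriedComp η Z)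
  constructor
  · intro h h' hh
    obtain ⟨p, rfl⟩ := (hΦ.val_bijective P Z).2 h
    obtain ⟨p', rfl⟩ := (hΦ.val_bijective P Z).2 h'
    refine congrArg _ (hb.1 (hΦ.val_ext fun x => hΦ.val_ext fun y => ?_))
    rw [val_uncurriedComp, val_uncurriedComp]
    exact LinearMap.congr_fun hh (x ⊗ₜ y)
  · intro f
    let w := LinearEquiv.ofBijective _ (hΦ.val_bijective Y Z)
    obtain ⟨q, hq⟩ := (hΦ.val_bijective X (ihObj S.ihom Y Z)).2
      (w.symm.toLinearMap ∘ₗ TensorProduct.curry f)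
    obtain ⟨p, rfl⟩ := hb.2 q
    refine ⟨Φ.val P Z p, TensorProduct.ext' fun x y => ?_⟩
    change Φ.val P Z p (Φ.val Y P (baseMap k η x) y) = _
    rw [← val_uncurriedComp, hq]
    exact LinearMap.congr_fun (w.apply_symm_apply (TensorProduct.curry f x)) y

/-- Precomposition is known to be bijective only for targets that carry an `A`-action, whereas `X ⊗
Y` has none yet. The remedy is to embed it as a `k`-linear direct summand of an `A`-module. -/
theorem IsStrong.tensorMap_bijective (hΦ : Φ.IsStrong) (hS : S.AssocNormal)
    (hη : S.IsUniversal η) : Function.Bijective (Φ.tensorMap η) := by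
  obtain ⟨e, he⟩ := hΦ.exists_functional
  let W := (forgetToBase k A).obj X ⊗[k] (forgetToBase k A).obj Y
  -- The map `w ↦ 1 ⊗ w` into `A ⊗ W` is split by `e`. Extending it along `tensorMap` and then
  -- applying `e` gives a left inverse `s`.
  let Z : ModuleCat.{u} A := ModuleCat.of A (A ⊗[k] W)
  let z : A ⊗[k] W ≃ₗ[k] (forgetToBase k A).obj Z :=
    { AddEquiv.refl _ with
      map_smul' := fun r t => (algebraMap_smul A r t).symm }
  obtain ⟨r, hr⟩ := (hΦ.bijective_comp_tensorMap hS hη Z).2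
    (z.toLinearMap ∘ₗ TensorProduct.mk k A W 1)
  let s : (forgetToBase k A).obj P →ₗ[k] W :=
    (TensorProduct.lid k W).toLinearMap ∘ₗ e.rTensor W ∘ₗ z.symm.toLinearMap ∘ₗ r
  have hs : s ∘ₗ Φ.tensorMap η = LinearMap.id := by
    refine LinearMap.ext fun w => ?_
    have h := LinearMap.congr_fun hr w
    change TensorProduct.lid k W (e.rTensor W (z.symm (r (Φ.tensorMap η w)))) = w
    change r (Φ.tensorMap η w) = z (1 ⊗ₜ w) at h
    rw [h, z.symm_apply_apply, LinearMap.rTensor_tmul, he, TensorProduct.lid_tmul, one_smul]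
  -- Uniqueness of extensions, now with target `P`, makes `s` two-sided.
  have hs' : Φ.tensorMap η ∘ₗ s = LinearMap.id :=
    (hΦ.bijective_comp_tensorMap hS hη P).1 (by
      change (Φ.tensorMap η ∘ₗ s) ∘ₗ Φ.tensorMap η = LinearMap.id ∘ₗ Φ.tensorMap η
      rw [LinearMap.comp_assoc, hs, LinearMap.comp_id, LinearMap.id_comp])
  exact Function.bijective_iff_has_inverse.2
    ⟨s, LinearMap.congr_fun hs, LinearMap.congr_fun hs'⟩

theorem IsStrong.exists_isUniversal (hΦ : Φ.IsStrong) (X Y : ModuleCat.{u} A) :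
    ∃ (P : ModuleCat.{u} A) (η : X ⟶ ihObj S.ihom Y P), S.IsUniversal η := by
  have := hΦ.ihom_isRightAdjoint Y
  let adj := Adjunction.ofIsRightAdjoint (S.ihom.obj (op Y))
  refine ⟨_, adj.unit.app X, fun V => ?_⟩
  have h : (fun h => adj.unit.app X ≫ ihMap S.ihom (𝟙 Y) h) = adj.homEquiv X V := by
    funext h
    rw [Adjunction.homEquiv_unit, ihom_map_eq_ihMap]
  exact h ▸ (adj.homEquiv X V).bijective

/-- If `Γ` is associatively normal, then tensor products of `k`-modules lift to `A`-modules. -/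
theorem IsStrong.exists_tensorLift (hΦ : Φ.IsStrong) (hS : S.AssocNormal) :
    ∃ T : Φ.TensorLift, ∀ X Y, IsIdentity (T.μIso X Y).hom := by
  choose P η hη using fun X Y : ModuleCat.{u} A => hΦ.exists_isUniversal X Y
  let e (X Y : ModuleCat.{u} A) :=
    LinearEquiv.ofBijective _ (hΦ.tensorMap_bijective hS (hη X Y))
  choose d hd using fun (X Y V : ModuleCat.{u} A) => (hη X Y V).2
  have hd' (X Y Z : ModuleCat.{u} A) (g : X ⟶ ihObj S.ihom Y Z) (x) (y) :
      baseMap k (d X Y Z g) (Φ.val Y (P X Y) (baseMap k (η X Y) x) y) =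
        Φ.val Y Z (baseMap k g x) y := by
    conv_rhs => rw [← hd X Y Z g]
    simp
  -- The representing object is replaced by its transport to the carrier `X ⊗ Y`, which turns the
  -- comparison from an isomorphism into an identity.
  refine ⟨
    { obj := fun X Y => transportObj (e X Y)
      μ := fun X Y => transportBaseEquiv (e X Y)
      η := fun X Y => η X Y ≫ ihMap S.ihom (𝟙 Y) (transportIso (e X Y)).inv
      val_η := fun X Y x y => by
        rw [baseMap_comp, val_ihMap]
        exact (e X Y).symm_apply_apply (x ⊗ₜ y)
      lift := fun {X Y Z} g => (transportIso (e X Y)).hom ≫ d X Y Z g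
      lift_μ := fun {X Y Z} g x y => hd' X Y Z g x y },
    fun X Y => transportBaseEquiv_isIdentity (e X Y)⟩

theorem exists_isStrictClosedMonoidal (hΦ : Φ.IsStrict) (hS : S.AssocNormal) :
    ∃ M : RightClosedMonoidal S,
      IsStrictClosedMonoidal M (baseClosedMonoidal k) (forgetToBase k A) := by
  obtain ⟨T, hT⟩ := hΦ.isStrong.exists_tensorLift hS
  exact ⟨_, T.isStrictClosedMonoidal hΦ hT⟩

end ClosedFunctor

theorem tfae_normal_closedMonoidal (k : Type u) {A : Type u} [CommRing k] [Ring A] [Algebra k A]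
    (S : SkewClosed (ModuleCat.{u} A)) :
    List.TFAE
      [ S.IsNormal ∧ IsStrictClosed S (baseSkewClosed k) (forgetToBase k A),
        ∃ M : RightClosedMonoidal S,
          IsStrictClosedMonoidal M (baseClosedMonoidal k) (forgetToBase k A),
        ∃ M : RightClosedMonoidal S, M.IsBiclosed ∧
          IsStrictClosedMonoidal M (baseClosedMonoidal k) (forgetToBase k A) ] := by
  tfae_have 1 → 2 := fun ⟨hS, _, hΦ⟩ => ClosedFunctor.exists_isStrictClosedMonoidal hΦ hS.assoc
  tfae_have 2 → 1 := fun ⟨M, Φ, _, hΦ, _⟩ => ⟨M.isNormal, Φ, hΦ⟩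
  tfae_have 2 → 3 := fun ⟨M, h⟩ => ⟨M, M.isBiclosed h, h⟩
  tfae_have 3 → 2 := fun ⟨M, _, h⟩ => ⟨M, h⟩
  tfae_finish

/-! ### Right linear extensions and coassociativity -/

section RightExtend

variable {k A : Type u} [CommRing k] [Ring A] [Algebra k A]

/-- The right `A`-linear extension `a ⊗ b ↦ f(a) (1 ⊗ b)` of `f : A → A ⊗ A`. -/
def rightExtend (f : A →ₗ[k] A ⊗[k] A) : A ⊗[k] A →ₗ[k] A ⊗[k] A :=
  TensorProduct.map LinearMap.id (LinearMap.mul' k A) ∘ₗ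
    (TensorProduct.assoc k A A A).toLinearMap ∘ₗ TensorProduct.map f LinearMap.id

@[simp]
theorem rightExtend_tmul (f : A →ₗ[k] A ⊗[k] A) (a b : A) :
    rightExtend f (a ⊗ₜ b) = f a * (1 ⊗ₜ b) := by
  simp only [rightExtend, LinearMap.comp_apply, TensorProduct.map_tmul, LinearMap.id_apply]
  induction f a with
  | zero => simp
  | add x y hx hy => simp only [TensorProduct.add_tmul, map_add, hx, hy, add_mul]
  | tmul x y => simp

theorem rightExtend_mul (f : A →ₗ[k] A ⊗[k] A) (t : A ⊗[k] A) (b : A) :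
    rightExtend f (t * (1 ⊗ₜ b)) = rightExtend f t * (1 ⊗ₜ b) := by
  induction t with
  | zero => simp
  | add x y hx hy => simp only [add_mul, map_add, hx, hy]
  | tmul x y => simp [mul_assoc]

/-- A right `A`-linear map on `A ⊗ A` is determined by its values on `a ⊗ 1`. -/
theorem rightExtend_comp_eq_id {f g : A →ₗ[k] A ⊗[k] A}
    (h : ∀ a, rightExtend f (g a) = a ⊗ₜ 1) (t : A ⊗[k] A) :
    rightExtend f (rightExtend g t) = t := by
  induction t with
  | zero => simp
  | add x y hx hy => simp only [map_add, hx, hy]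
  | tmul x y => simp [rightExtend_mul, h]

/-- The map acting on the first two factors. -/
def leg₁₂ (φ : A ⊗[k] A →ₗ[k] A ⊗[k] A) : A ⊗[k] (A ⊗[k] A) →ₗ[k] A ⊗[k] (A ⊗[k] A) :=
  (TensorProduct.assoc k A A A).toLinearMap ∘ₗ φ.rTensor A ∘ₗ
    (TensorProduct.assoc k A A A).symm.toLinearMap

/-- The map acting on the first and the last factor. -/
def leg₁₃ (φ : A ⊗[k] A →ₗ[k] A ⊗[k] A) : A ⊗[k] (A ⊗[k] A) →ₗ[k] A ⊗[k] (A ⊗[k] A) :=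
  (TensorProduct.leftComm k A A A).toLinearMap ∘ₗ φ.lTensor A ∘ₗ
    (TensorProduct.leftComm k A A A).toLinearMap

theorem lTensor_apply_apply {φ ψ : A ⊗[k] A →ₗ[k] A ⊗[k] A} (h : ∀ t, φ (ψ t) = t)
    (t : A ⊗[k] (A ⊗[k] A)) : φ.lTensor A (ψ.lTensor A t) = t := by
  have h' : φ ∘ₗ ψ = LinearMap.id := LinearMap.ext h
  rw [← LinearMap.comp_apply, ← LinearMap.lTensor_comp, h', LinearMap.lTensor_id,
    LinearMap.id_apply]

theorem leg₁₂_apply_apply {φ ψ : A ⊗[k] A →ₗ[k] A ⊗[k] A} (h : ∀ t, φ (ψ t) = t)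
    (t : A ⊗[k] (A ⊗[k] A)) : leg₁₂ φ (leg₁₂ ψ t) = t := by
  have h' : φ ∘ₗ ψ = LinearMap.id := LinearMap.ext h
  have h'' (s) : φ.rTensor A (ψ.rTensor A s) = s := by
    rw [← LinearMap.comp_apply, ← LinearMap.rTensor_comp, h', LinearMap.rTensor_id,
      LinearMap.id_apply]
  simp [leg₁₂, h'']

theorem leg₁₃_apply_apply {φ ψ : A ⊗[k] A →ₗ[k] A ⊗[k] A} (h : ∀ t, φ (ψ t) = t)
    (t : A ⊗[k] (A ⊗[k] A)) : leg₁₃ φ (leg₁₃ ψ t) = t := by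
  have h₁ (s : A ⊗[k] (A ⊗[k] A)) :
      TensorProduct.leftComm k A A A (TensorProduct.leftComm k A A A s) = s :=
    (TensorProduct.leftComm k A A A).symm_apply_apply s
  simp only [leg₁₃, LinearMap.comp_apply, LinearEquiv.coe_coe, h₁, lTensor_apply_apply h]

theorem leg₁₂_rightExtend (f : A →ₗ[k] A ⊗[k] A) (a b c : A) :
    leg₁₂ (rightExtend f) (a ⊗ₜ (b ⊗ₜ c)) =
      TensorProduct.assoc k A A A (f a ⊗ₜ 1) * (1 ⊗ₜ (b ⊗ₜ c)) := by
  simp only [leg₁₂, LinearMap.comp_apply, LinearEquiv.coe_coe, TensorProduct.assoc_symm_tmul,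
    LinearMap.rTensor_tmul, rightExtend_tmul]
  induction f a with
  | zero => simp
  | add x y hx hy => simp only [TensorProduct.add_tmul, map_add, hx, hy, add_mul]
  | tmul x y => simp

theorem assoc_rightExtend_one (f : A →ₗ[k] A ⊗[k] A) (a : A) :
    TensorProduct.assoc k A A A (f a ⊗ₜ 1) = leg₁₂ (rightExtend f) (a ⊗ₜ 1) := by
  rw [Algebra.TensorProduct.one_def, leg₁₂_rightExtend, ← Algebra.TensorProduct.one_def,
    ← Algebra.TensorProduct.one_def, mul_one]

/-- When `f` is a comultiplication, this side produces the coproduct iterated in the left factor;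
`leg₂₃_rightExtend` produces the one iterated in the right factor. Comparing the two makes
coassociativity a pentagon identity. -/
theorem leg₁₃_rightExtend (f : A →ₗ[k] A ⊗[k] A) (a : A) (s : A ⊗[k] A) :
    leg₁₂ (rightExtend f) (leg₁₃ (rightExtend f) (a ⊗ₜ s)) =
      TensorProduct.assoc k A A A (f.rTensor A (f a)) * (1 ⊗ₜ s) := by
  induction s with
  | zero => simp
  | add x y hx hy => simp only [TensorProduct.tmul_add, map_add, hx, hy, mul_add]
  | tmul b c =>
    simp only [leg₁₃, LinearMap.comp_apply, LinearEquiv.coe_coe, TensorProduct.leftComm_tmul,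
      LinearMap.lTensor_tmul, rightExtend_tmul]
    induction f a with
    | zero => simp
    | add x y hx hy => simp only [add_mul, TensorProduct.tmul_add, map_add, hx, hy]
    | tmul x y =>
      simp only [Algebra.TensorProduct.tmul_mul_tmul, mul_one, TensorProduct.leftComm_tmul,
        leg₁₂_rightExtend, LinearMap.rTensor_tmul]
      induction f x with
      | zero => simp
      | add x y hx hy => simp only [TensorProduct.add_tmul, map_add, hx, hy, add_mul]
      | tmul x y => simp

/-- Multiplicativity of `f` is what lets the factor `1 ⊗ s` be pulled out past the second
application of `f`. -/
theorem leg₂₃_rightExtend {f : A →ₗ[k] A ⊗[k] A} (hf : ∀ a b, f (a * b) = f a * f b)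
    (a : A) (s : A ⊗[k] A) :
    (rightExtend f).lTensor A (leg₁₂ (rightExtend f) (a ⊗ₜ s)) =
      f.lTensor A (f a) * (1 ⊗ₜ rightExtend f s) := by
  induction s with
  | zero => simp
  | add x y hx hy => simp only [TensorProduct.tmul_add, map_add, hx, hy, mul_add]
  | tmul b c =>
    rw [leg₁₂_rightExtend]
    induction f a with
    | zero => simp
    | add x y hx hy => simp only [TensorProduct.add_tmul, map_add, hx, hy, add_mul]
    | tmul x y => simp [hf, mul_assoc]

/-- This expresses the left side of the third gabi axiom by legs of `β`. With `β₁₂(a ⊗ 1 ⊗ 1) = a₊ ⊗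
a₋ ⊗ 1`, the axiom says that `β₂₃ β₁₃ β₁₂` and `β₁₂` agree on `a ⊗ 1 ⊗ 1`. -/
theorem leg₂₃_leg₁₃_rightExtend (f : A →ₗ[k] A ⊗[k] A) (p : A ⊗[k] A) :
    (rightExtend f).lTensor A (leg₁₃ (rightExtend f) (TensorProduct.assoc k A A A (p ⊗ₜ 1))) =
      TensorProduct.assoc k A A A (gabiContract k A (TensorProduct.map f f p)) := by
  induction p with
  | zero => simp
  | add x y hx hy => simp only [TensorProduct.add_tmul, map_add, hx, hy]
  | tmul p r =>
    have h : leg₁₃ (rightExtend f) (TensorProduct.assoc k A A A ((p ⊗ₜ r) ⊗ₜ 1)) =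
        TensorProduct.leftComm k A A A (r ⊗ₜ f p) := by
      simp [leg₁₃, ← Algebra.TensorProduct.one_def]
    rw [h, TensorProduct.map_tmul]
    induction f p with
    | zero => simp
    | add x y hx hy => simp only [TensorProduct.add_tmul, TensorProduct.tmul_add, map_add, hx, hy]
    | tmul x y =>
      rw [TensorProduct.leftComm_tmul, LinearMap.lTensor_tmul, rightExtend_tmul]
      induction f r with
      | zero => simp
      | add x y hx hy => simp only [TensorProduct.tmul_add, map_add, hx, hy, add_mul]
      | tmul z w => simp [gabiContract]

variable {f g : A →ₗ[k] A ⊗[k] A}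

/-- Coassociativity gives the pentagon `γ₂₃ γ₁₂ = γ₁₂ γ₁₃ γ₂₃` for `γ = rightExtend g`, the inverse
of `rightExtend f`. Applying the injective `γ₂₃ γ₁₂` to both sides of the claim yields `a ⊗ 1 ⊗ 1`
twice. -/
theorem gabiContract_of_coassoc (hfg : ∀ a, rightExtend f (g a) = a ⊗ₜ 1)
    (hgf : ∀ a, rightExtend g (f a) = a ⊗ₜ 1) (hg : ∀ a b, g (a * b) = g a * g b) (hg1 : g 1 = 1)
    (hc : ∀ a, TensorProduct.assoc k A A A (g.rTensor A (g a)) = g.lTensor A (g a)) (a : A) :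
    gabiContract k A (TensorProduct.map f f (f a)) = f a ⊗ₜ 1 := by
  have h₁ := rightExtend_comp_eq_id hfg
  have h₂ := rightExtend_comp_eq_id hgf
  have pent (t : A ⊗[k] (A ⊗[k] A)) :
      (rightExtend g).lTensor A (leg₁₂ (rightExtend g) t) =
        leg₁₂ (rightExtend g) (leg₁₃ (rightExtend g) ((rightExtend g).lTensor A t)) := by
    induction t with
    | zero => simp
    | add x y hx hy => simp only [map_add, hx, hy]
    | tmul x s => rw [leg₂₃_rightExtend hg, LinearMap.lTensor_tmul, leg₁₃_rightExtend, hc]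
  refine (TensorProduct.assoc k A A A).injective ?_
  rw [← leg₂₃_leg₁₃_rightExtend]
  refine Function.LeftInverse.injective (leg₁₂_apply_apply h₁) ?_
  refine Function.LeftInverse.injective (lTensor_apply_apply h₁) ?_
  rw [pent, lTensor_apply_apply h₂, leg₁₃_apply_apply h₂,
    assoc_rightExtend_one, leg₁₂_apply_apply h₂, LinearMap.lTensor_tmul,
    Algebra.TensorProduct.one_def, rightExtend_tmul, hg1, ← Algebra.TensorProduct.one_def, mul_one]

/-- The gabi axiom gives the pentagon only on elements `f b ⊗ 1`. These suffice, because
`rightExtend f` is surjective, so the `f b` generate `A ⊗ A` as a right `A`-module. -/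
theorem coassoc_of_gabiContract (hfg : ∀ a, rightExtend f (g a) = a ⊗ₜ 1)
    (hgf : ∀ a, rightExtend g (f a) = a ⊗ₜ 1) (hg : ∀ a b, g (a * b) = g a * g b) (hg1 : g 1 = 1)
    (hc : ∀ a, gabiContract k A (TensorProduct.map f f (f a)) = f a ⊗ₜ 1) (a : A) :
    TensorProduct.assoc k A A A (g.rTensor A (g a)) = g.lTensor A (g a) := by
  have h₁ := rightExtend_comp_eq_id hfg
  have h₂ := rightExtend_comp_eq_id hgf
  -- `D` is the defect of coassociativity, and `Λ(a ⊗ b) = D(a) (1 ⊗ g b)` is the defect of the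
  -- pentagon at `a ⊗ b ⊗ 1`. Since `g 1 = 1`, the value `Λ(a ⊗ 1)` recovers `D(a)`.
  let D : A →ₗ[k] A ⊗[k] (A ⊗[k] A) :=
    (TensorProduct.assoc k A A A).toLinearMap ∘ₗ g.rTensor A ∘ₗ g - g.lTensor A ∘ₗ g
  let Λ : A ⊗[k] A →ₗ[k] A ⊗[k] (A ⊗[k] A) :=
    LinearMap.mul' k (A ⊗[k] (A ⊗[k] A)) ∘ₗ
      TensorProduct.map D (TensorProduct.mk k A (A ⊗[k] A) 1 ∘ₗ g)
  have hΛ (p : A ⊗[k] A) : Λ p =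
      leg₁₂ (rightExtend g) (leg₁₃ (rightExtend g)
        ((rightExtend g).lTensor A (TensorProduct.assoc k A A A (p ⊗ₜ 1)))) -
      (rightExtend g).lTensor A (leg₁₂ (rightExtend g)
        (TensorProduct.assoc k A A A (p ⊗ₜ 1))) := by
    induction p with
    | zero => simp
    | add x y hx hy =>
      simp only [TensorProduct.add_tmul, map_add, hx, hy]
      abel
    | tmul x y =>
      rw [TensorProduct.assoc_tmul, leg₂₃_rightExtend hg, LinearMap.lTensor_tmul,
        leg₁₃_rightExtend, rightExtend_tmul, ← Algebra.TensorProduct.one_def, mul_one, ← sub_mul]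
      rfl
  have hf (b : A) : Λ (f b) = 0 := by
    have h := leg₂₃_leg₁₃_rightExtend f (f b)
    rw [hc] at h
    have h' : leg₁₃ (rightExtend g) ((rightExtend g).lTensor A
        (TensorProduct.assoc k A A A (f b ⊗ₜ 1))) =
        TensorProduct.assoc k A A A (f b ⊗ₜ 1) := by
      conv_lhs => rw [← h]
      rw [lTensor_apply_apply h₂, leg₁₃_apply_apply h₂]
    rw [hΛ, h', assoc_rightExtend_one, leg₁₂_apply_apply h₂, LinearMap.lTensor_tmul,
      Algebra.TensorProduct.one_def, rightExtend_tmul, hg1, ← Algebra.TensorProduct.one_def,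
      mul_one, sub_self]
  have hmul (t : A ⊗[k] A) (b : A) : Λ (t * (1 ⊗ₜ b)) = Λ t * (1 ⊗ₜ g b) := by
    induction t with
    | zero => simp
    | add x y hx hy => simp only [add_mul, map_add, hx, hy]
    | tmul x y => simp [Λ, hg, mul_assoc]
  have hz (t : A ⊗[k] A) : Λ t = 0 := by
    rw [← h₁ t]
    induction rightExtend g t with
    | zero => simp
    | add x y hx hy => simp only [map_add, hx, hy, add_zero]
    | tmul x y => rw [rightExtend_tmul, hmul, hf, zero_mul]
  have h := hz (a ⊗ₜ 1)
  refine sub_eq_zero.1 (Eq.trans ?_ h)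
  simp [Λ, D, hg1, ← Algebra.TensorProduct.one_def]

theorem rightExtend_lTensor_comp (σ : A →ₗ[k] A) (t : A ⊗[k] A) :
    rightExtend (σ.lTensor A ∘ₗ g) t =
      (LinearMap.mul' k A ∘ₗ σ.rTensor A).lTensor A
        (TensorProduct.assoc k A A A (g.rTensor A t)) := by
  induction t with
  | zero => simp
  | add x y hx hy => simp only [map_add, hx, hy]
  | tmul x y =>
    rw [rightExtend_tmul, LinearMap.rTensor_tmul, LinearMap.comp_apply]
    induction g x with
    | zero => simp
    | add z w hz hw => simp only [TensorProduct.add_tmul, map_add, add_mul, hz, hw]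
    | tmul z w => simp

theorem rightExtend_lTensor_apply (σ : A →ₗ[k] A) (t : A ⊗[k] A) :
    rightExtend g (σ.lTensor A t) =
      (LinearMap.mul' k A ∘ₗ σ.lTensor A).lTensor A
        (TensorProduct.assoc k A A A (g.rTensor A t)) := by
  induction t with
  | zero => simp
  | add x y hx hy => simp only [map_add, hx, hy]
  | tmul x y =>
    rw [LinearMap.lTensor_tmul, rightExtend_tmul, LinearMap.rTensor_tmul]
    induction g x with
    | zero => simp
    | add z w hz hw => simp only [TensorProduct.add_tmul, map_add, add_mul, hz, hw]
    | tmul z w => simp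

/-- For `φ` built from multiplication and an antipode, this is the collapse `a₁ ⊗ φ(a₂ ⊗ a₃) = a₁ ⊗
ε(a₂) 1 = a ⊗ 1`. -/
theorem lTensor_lTensor_eq_tmul_one {ε : A →ₗ[k] k} (hε : ∀ a, ε.lTensor A (g a) = a ⊗ₜ 1)
    {φ : A ⊗[k] A →ₗ[k] A} (hφ : φ ∘ₗ g = Algebra.linearMap k A ∘ₗ ε) (a : A) :
    φ.lTensor A (g.lTensor A (g a)) = a ⊗ₜ 1 := by
  rw [← LinearMap.comp_apply, ← LinearMap.lTensor_comp, hφ, LinearMap.lTensor_comp,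
    LinearMap.comp_apply, hε]
  simp

end RightExtend

/-! ### From gabi-algebras to Hopf algebras -/

namespace GabiStructure

variable {k A : Type u} [CommRing k] [Ring A] [Algebra k A] (G : GabiStructure k A)

/-- The map `a ↦ a₊ ⊗ a₋` to `A ⊗ A`. -/
def split : A →ₗ[k] A ⊗[k] A := unopTensor k A ∘ₗ G.δ.toLinearMap

theorem canonicalMap_eq : G.canonicalMap = rightExtend G.split := rfl

theorem split_one : G.split 1 = 1 := by
  simp [split, unopTensor, Algebra.TensorProduct.one_def]

theorem canonicalMap_tmul_one (a : A) : G.canonicalMap (a ⊗ₜ 1) = G.split a := by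
  rw [canonicalMap_eq, rightExtend_tmul, ← Algebra.TensorProduct.one_def, mul_one]

theorem canonicalMap_one_tmul (a : A) : G.canonicalMap (1 ⊗ₜ a) = 1 ⊗ₜ a := by
  rw [canonicalMap_eq, rightExtend_tmul, split_one, one_mul]

/-- The canonical map, with values in `A ⊗ Aᵒᵖ`. -/
def canonicalMapOp : A ⊗[k] A →ₗ[k] A ⊗[k] Aᵐᵒᵖ :=
  LinearMap.mul' k (A ⊗[k] Aᵐᵒᵖ) ∘ₗ (TensorProduct.comm k _ _).toLinearMap ∘ₗ
    TensorProduct.map G.δ.toLinearMap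
      (TensorProduct.mk k A Aᵐᵒᵖ 1 ∘ₗ (MulOpposite.opLinearEquiv k (M := A)).toLinearMap)

theorem canonicalMapOp_tmul (a b : A) :
    G.canonicalMapOp (a ⊗ₜ b) = (1 ⊗ₜ MulOpposite.op b) * G.δ a := by
  simp [canonicalMapOp]

theorem unopTensor_op_mul (b : A) (t : A ⊗[k] Aᵐᵒᵖ) :
    unopTensor k A ((1 ⊗ₜ MulOpposite.op b) * t) = unopTensor k A t * (1 ⊗ₜ b) := by
  induction t with
  | zero => simp
  | add x y hx hy => simp only [mul_add, add_mul, map_add, hx, hy]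
  | tmul x y => simp [unopTensor]

theorem unopTensor_canonicalMapOp (t : A ⊗[k] A) :
    unopTensor k A (G.canonicalMapOp t) = G.canonicalMap t := by
  induction t with
  | zero => simp
  | add x y hx hy => simp only [map_add, hx, hy]
  | tmul x y =>
    rw [canonicalMapOp_tmul, unopTensor_op_mul, canonicalMap_eq, rightExtend_tmul]
    rfl

theorem unopTensor_injective : Function.Injective (unopTensor k A) :=
  (TensorProduct.congr (LinearEquiv.refl k A)
    (MulOpposite.opLinearEquiv k (M := A)).symm).injective

/-- In the algebra `A ⊗ Aᵒᵖ` the canonical map is `a ⊗ b ↦ (1 ⊗ b) δ(a)`. Since `δ` is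
multiplicative and `op` reverses products, the new factors land on the two outer sides. -/
theorem canonicalMapOp_mul (t : A ⊗[k] A) (a b : A) :
    G.canonicalMapOp (t * (a ⊗ₜ b)) = (1 ⊗ₜ MulOpposite.op b) * G.canonicalMapOp t * G.δ a := by
  induction t with
  | zero => simp
  | add x y hx hy => simp only [mul_add, add_mul, map_add, hx, hy]
  | tmul x y =>
    rw [Algebra.TensorProduct.tmul_mul_tmul, canonicalMapOp_tmul, canonicalMapOp_tmul, map_mul,
      MulOpposite.op_mul, ← mul_assoc, ← mul_assoc, Algebra.TensorProduct.tmul_mul_tmul, one_mul]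

theorem canonicalMapOp_of_canonicalMap {t : A ⊗[k] A} {a : A} (ht : G.canonicalMap t = a ⊗ₜ 1) :
    G.canonicalMapOp t = a ⊗ₜ 1 :=
  unopTensor_injective (by
    rw [unopTensor_canonicalMapOp, ht]
    simp [unopTensor])

/-- If `β(t) = a ⊗ 1` then `β(t s) = (a ⊗ 1) β(s)`. -/
theorem canonicalMap_mul {t : A ⊗[k] A} {a : A} (ht : G.canonicalMap t = a ⊗ₜ 1)
    (s : A ⊗[k] A) : G.canonicalMap (t * s) = (a ⊗ₜ 1) * G.canonicalMap s := by
  have ht' := G.canonicalMapOp_of_canonicalMap ht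
  have h : G.canonicalMapOp (t * s) = (a ⊗ₜ 1) * G.canonicalMapOp s := by
    induction s with
    | zero => simp
    | add x y hx hy => simp only [mul_add, map_add, hx, hy]
    | tmul x y =>
      -- The elements `a ⊗ 1` and `1 ⊗ op y` commute.
      rw [canonicalMapOp_mul, canonicalMapOp_tmul, ht', ← mul_assoc]
      simp
  rw [← unopTensor_canonicalMapOp, ← unopTensor_canonicalMapOp, h]
  induction G.canonicalMapOp s with
  | zero => simp
  | add x y hx hy => simp only [mul_add, map_add, hx, hy]
  | tmul x y => simp [unopTensor]

/-- Right linear extension of `a₊ a₋ = ε(a) 1`. At `t = Δ(a)` it becomes the left counit law. -/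
theorem mul'_canonicalMap (t : A ⊗[k] A) :
    LinearMap.mul' k A (G.canonicalMap t) =
      TensorProduct.lid k A (G.ε.toLinearMap.rTensor A t) := by
  have h (s : A ⊗[k] A) (b : A) :
      LinearMap.mul' k A (s * (1 ⊗ₜ b)) = LinearMap.mul' k A s * b := by
    induction s with
    | zero => simp
    | add x y hx hy => simp only [add_mul, map_add, hx, hy]
    | tmul x y => simp [mul_assoc]
  induction t with
  | zero => simp
  | add x y hx hy => simp only [map_add, hx, hy]
  | tmul x y =>
    rw [canonicalMap_eq, rightExtend_tmul, h]
    refine (congrArg (· * y) (G.mul_plus_minus x)).trans ?_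
    simp [Algebra.smul_def]

/-- Right linear extension of `a₊ ε(a₋) = a`. At `t = Δ(a)` it becomes the right counit law. -/
theorem counit_canonicalMap (t : A ⊗[k] A) :
    TensorProduct.rid k A (G.ε.toLinearMap.lTensor A (G.canonicalMap t)) =
      TensorProduct.rid k A (G.ε.toLinearMap.lTensor A t) := by
  have h (s : A ⊗[k] A) (b : A) :
      TensorProduct.rid k A (G.ε.toLinearMap.lTensor A (s * (1 ⊗ₜ b))) =
        G.ε b • TensorProduct.rid k A (G.ε.toLinearMap.lTensor A s) := by
    induction s with
    | zero => simp
    | add x y hx hy => simp only [add_mul, map_add, hx, hy, smul_add]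
    | tmul x y => simp [mul_smul, smul_comm (G.ε b)]
  induction t with
  | zero => simp
  | add x y hx hy => simp only [map_add, hx, hy]
  | tmul x y =>
    rw [canonicalMap_eq, rightExtend_tmul, h]
    refine (congrArg (G.ε y • ·) (G.counitality x)).trans ?_
    simp

theorem antipode_apply (a : A) :
    G.antipode a = TensorProduct.lid k A (G.ε.toLinearMap.rTensor A (G.split a)) := rfl

/-- At `t = Δ(a)` this becomes the left antipode law `σ(a₁) a₂ = ε(a) 1`. -/
theorem counit_rTensor_canonicalMap (t : A ⊗[k] A) :
    TensorProduct.lid k A (G.ε.toLinearMap.rTensor A (G.canonicalMap t)) =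
      LinearMap.mul' k A (G.antipode.rTensor A t) := by
  have h (s : A ⊗[k] A) (b : A) :
      TensorProduct.lid k A (G.ε.toLinearMap.rTensor A (s * (1 ⊗ₜ b))) =
        TensorProduct.lid k A (G.ε.toLinearMap.rTensor A s) * b := by
    induction s with
    | zero => simp
    | add x y hx hy => simp only [add_mul, map_add, hx, hy]
    | tmul x y => simp
  induction t with
  | zero => simp
  | add x y hx hy => simp only [map_add, hx, hy]
  | tmul x y => rw [canonicalMap_eq, rightExtend_tmul, h, LinearMap.rTensor_tmul,
      LinearMap.mul'_apply, antipode_apply]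

variable (hG : Function.Bijective G.canonicalMap)

/-- The comultiplication `a ↦ β⁻¹(a ⊗ 1)`. -/
def comulOfBijective : A →ₗ[k] A ⊗[k] A :=
  (LinearEquiv.ofBijective G.canonicalMap hG).symm.toLinearMap ∘ₗ (TensorProduct.mk k A A).flip 1

theorem canonicalMap_comul (a : A) : G.canonicalMap (G.comulOfBijective hG a) = a ⊗ₜ 1 :=
  (LinearEquiv.ofBijective G.canonicalMap hG).apply_symm_apply _

theorem comul_eq_iff {a : A} {t : A ⊗[k] A} :
    G.comulOfBijective hG a = t ↔ G.canonicalMap t = a ⊗ₜ 1 := by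
  rw [← hG.1.eq_iff, canonicalMap_comul, eq_comm]

/-- The right linear extension of `Δ` is a right inverse of `β` by construction; injectivity of `β`
makes it a left inverse. -/
theorem rightExtend_comul_split (a : A) :
    rightExtend (G.comulOfBijective hG) (G.split a) = a ⊗ₜ 1 := by
  refine hG.1 ?_
  rw [canonicalMap_tmul_one]
  exact rightExtend_comp_eq_id (G.canonicalMap_comul hG) _

theorem comul_one : G.comulOfBijective hG 1 = 1 :=
  (G.comul_eq_iff hG).2 (G.canonicalMap_one_tmul 1)

theorem comul_mul (a b : A) : G.comulOfBijective hG (a * b) =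
    G.comulOfBijective hG a * G.comulOfBijective hG b :=
  (G.comul_eq_iff hG).2 (by
    rw [G.canonicalMap_mul (G.canonicalMap_comul hG a), canonicalMap_comul]
    simp)

theorem comul_coassoc (a : A) :
    TensorProduct.assoc k A A A ((G.comulOfBijective hG).rTensor A (G.comulOfBijective hG a)) =
      (G.comulOfBijective hG).lTensor A (G.comulOfBijective hG a) :=
  coassoc_of_gabiContract (f := G.split) (G.canonicalMap_comul hG) (G.rightExtend_comul_split hG)
    (G.comul_mul hG) (G.comul_one hG) G.associativity a

theorem counit_lTensor_comul (a : A) :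
    G.ε.toLinearMap.lTensor A (G.comulOfBijective hG a) = a ⊗ₜ 1 := by
  refine (TensorProduct.rid k A).injective ?_
  rw [← counit_canonicalMap, canonicalMap_comul]
  simp

theorem mul'_antipode_comul (a : A) :
    LinearMap.mul' k A (G.antipode.rTensor A (G.comulOfBijective hG a)) =
      algebraMap k A (G.ε a) := by
  rw [← counit_rTensor_canonicalMap, canonicalMap_comul]
  simp [Algebra.smul_def]

/-- `a₁ ⊗ σ(a₂) = a₊ ⊗ a₋`. -/
theorem antipode_lTensor_comul (a : A) :
    G.antipode.lTensor A (G.comulOfBijective hG a) = G.split a := by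
  -- The extension of `a ↦ a₁ ⊗ σ(a₂)` is a left inverse of `β⁻¹`, hence equals `β`; its value at `a
  -- ⊗ 1` is the claim.
  have h (b : A) : rightExtend (G.antipode.lTensor A ∘ₗ G.comulOfBijective hG)
      (G.comulOfBijective hG b) = b ⊗ₜ 1 := by
    rw [rightExtend_lTensor_comp, comul_coassoc]
    exact lTensor_lTensor_eq_tmul_one (G.counit_lTensor_comul hG)
      (LinearMap.ext (G.mul'_antipode_comul hG)) b
  have h' := rightExtend_comp_eq_id h (G.split a)
  rw [rightExtend_comul_split, rightExtend_tmul, ← Algebra.TensorProduct.one_def, mul_one] at h'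
  exact h'

/-- The Hopf algebra structure of a gabi-algebra with bijective canonical map. -/
def toHopfStructure : HopfStructure k A where
  comul := G.comulOfBijective hG
  counit := G.ε.toLinearMap
  coassoc := LinearMap.ext (G.comul_coassoc hG)
  rTensor_counit_comp_comul := LinearMap.ext fun a => by
    refine (TensorProduct.lid k A).injective ?_
    rw [LinearMap.comp_apply, ← mul'_canonicalMap, canonicalMap_comul]
    simp
  lTensor_counit_comp_comul := LinearMap.ext (G.counit_lTensor_comul hG)
  counit_one := map_one G.ε
  counit_mul := map_mul G.ε
  comul_one := G.comul_one hG
  comul_mul := G.comul_mul hG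
  antipode := G.antipode
  mul_antipode_left := LinearMap.ext (G.mul'_antipode_comul hG)
  mul_antipode_right := LinearMap.ext fun a => by
    rw [LinearMap.comp_apply, LinearMap.comp_apply, antipode_lTensor_comul]
    exact G.mul_plus_minus a

end GabiStructure

/-! ### From Hopf algebras to gabi-algebras -/

namespace HopfStructure

variable {k A : Type u} [CommRing k] [Ring A] [Algebra k A] (H : HopfStructure k A)

/-- The algebra map `a ↦ a₁ ⊗ S(a₂)`. -/
def delta : A →ₐ[k] A ⊗[k] Aᵐᵒᵖ :=
  letI := H.toHopfAlgebra
  (Algebra.TensorProduct.map (AlgHom.id k A) (HopfAlgebra.antipodeAlgHomOp k A)).comp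
    (Bialgebra.comulAlgHom k A)

theorem unopTensor_delta (a : A) :
    unopTensor k A (H.delta a) = H.antipode.lTensor A (H.comul a) := by
  change unopTensor k A (TensorProduct.map LinearMap.id
    ((MulOpposite.opLinearEquiv k).toLinearMap ∘ₗ H.antipode) (H.comul a)) = _
  induction H.comul a with
  | zero => simp
  | add x y hx hy => simp only [map_add, hx, hy]
  | tmul x y => simp [unopTensor]

/-- In Sweedler notation, `a₁ ⊗ S(a₂) a₃ = a ⊗ 1`. The companion `rightExtend_comul_split` is `a₁ ⊗
a₂ S(a₃) = a ⊗ 1`, so together they invert `β`. -/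
theorem rightExtend_split_comul (a : A) :
    rightExtend (H.antipode.lTensor A ∘ₗ H.comul) (H.comul a) = a ⊗ₜ 1 := by
  rw [rightExtend_lTensor_comp]
  refine (congrArg _ (LinearMap.congr_fun H.coassoc a)).trans ?_
  exact lTensor_lTensor_eq_tmul_one (LinearMap.congr_fun H.lTensor_counit_comp_comul)
    H.mul_antipode_left a

theorem rightExtend_comul_split (a : A) :
    rightExtend H.comul (H.antipode.lTensor A (H.comul a)) = a ⊗ₜ 1 := by
  rw [rightExtend_lTensor_apply]
  refine (congrArg _ (LinearMap.congr_fun H.coassoc a)).trans ?_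
  exact lTensor_lTensor_eq_tmul_one (LinearMap.congr_fun H.lTensor_counit_comp_comul)
    H.mul_antipode_right a

theorem counit_antipode (a : A) : H.counit (H.antipode a) = H.counit a :=
  letI := H.toHopfAlgebra
  HopfAlgebra.counit_antipode a

/-- The gabi-algebra structure of a Hopf algebra. -/
def toGabiStructure : GabiStructure k A where
  ε := AlgHom.ofLinearMap H.counit H.counit_one H.counit_mul
  δ := H.delta
  counitality a := by
    have h : H.counit ∘ₗ H.antipode = H.counit := LinearMap.ext H.counit_antipode
    rw [unopTensor_delta]
    change TensorProduct.rid k A (H.counit.lTensor A (H.antipode.lTensor A (H.comul a))) = a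
    rw [← LinearMap.comp_apply, ← LinearMap.lTensor_comp, h]
    refine (congrArg _ (LinearMap.congr_fun H.lTensor_counit_comp_comul a)).trans ?_
    simp
  mul_plus_minus a := by
    rw [unopTensor_delta]
    exact LinearMap.congr_fun H.mul_antipode_right a
  associativity a := by
    have h : unopTensor k A ∘ₗ H.delta.toLinearMap = H.antipode.lTensor A ∘ₗ H.comul :=
      LinearMap.ext H.unopTensor_delta
    rw [h, unopTensor_delta]
    exact gabiContract_of_coassoc (f := H.antipode.lTensor A ∘ₗ H.comul) (g := H.comul)
      H.rightExtend_split_comul H.rightExtend_comul_split H.comul_mul H.comul_one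
      (LinearMap.congr_fun H.coassoc) a

theorem toGabiStructure_split : H.toGabiStructure.split = H.antipode.lTensor A ∘ₗ H.comul :=
  LinearMap.ext H.unopTensor_delta

theorem canonicalMap_bijective : Function.Bijective H.toGabiStructure.canonicalMap := by
  rw [GabiStructure.canonicalMap_eq, toGabiStructure_split]
  exact Function.bijective_iff_has_inverse.2
    ⟨rightExtend H.comul, rightExtend_comp_eq_id H.rightExtend_comul_split,
      rightExtend_comp_eq_id H.rightExtend_split_comul⟩

end HopfStructure

/-! ### Normality and bijectivity of the canonical map -/

namespace GabiStructure

variable {k A : Type u} [CommRing k] [Ring A] [Algebra k A] (G : GabiStructure k A)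

/-- The identity map from `k` to the trivial module. -/
def unitEquiv : k ≃ₗ[k] (forgetToBase k A).obj G.skewClosed.unit where
  toFun r := r
  invFun r := r
  left_inv _ := rfl
  right_inv _ := rfl
  map_add' _ _ := rfl
  map_smul' r x := by
    change r * x = G.ε (algebraMap k A r) * x
    rw [AlgHom.commutes]
    rfl

/-- The identity map from the module `[X, Y]` to `Hom_k(X, Y)`. -/
def ihomEquiv (X Y : ModuleCat.{u} A) :
    (forgetToBase k A).obj (ihObj G.skewClosed.ihom X Y) ≃ₗ[k]
      ((forgetToBase k A).obj X →ₗ[k] (forgetToBase k A).obj Y) where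
  toFun p := G.toLin p
  invFun p := p
  left_inv _ := rfl
  right_inv _ := rfl
  map_add' _ _ := rfl
  map_smul' r p := G.algebraMap_smul r (show G.Hom X Y from p)

/-- The forgetful functor is closed. -/
def closedFunctor : ClosedFunctor G.skewClosed (baseSkewClosed k) (forgetToBase k A) where
  F₀ := G.unitEquiv.toModuleIso.hom
  F₂ X Y := (G.ihomEquiv X Y).toModuleIso.hom
  F₂_natural _ _ := rfl
  j_comp _ := rfl
  i_comp _ := rfl
  Γ_comp _ _ _ := rfl

/-- The comparison maps are identities on elements. Invertibility is all that the later arguments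
require of them, so the objects need not be shown equal. -/
theorem closedFunctor_isStrong : G.closedFunctor.IsStrong where
  isIso_F₀ := G.unitEquiv.toModuleIso.isIso_hom
  isIso_F₂ X Y := (G.ihomEquiv X Y).toModuleIso.isIso_hom

theorem val_smul {X Y : ModuleCat.{u} A} (a : A)
    (p : (forgetToBase k A).obj (ihObj G.skewClosed.ihom X Y)) :
    G.closedFunctor.val X Y (a • p) =
      twoSidedAction k _ _ (G.δ a) (G.closedFunctor.val X Y p) := rfl

/-! ### Bijectivity of the canonical map implies normality -/

section Bijective

variable (hG : Function.Bijective G.canonicalMap)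

/-- The comultiplication, as an algebra map. -/
def comulAlgHom : A →ₐ[k] A ⊗[k] A :=
  AlgHom.ofLinearMap (G.comulOfBijective hG) (G.comul_one hG) (G.comul_mul hG)

/-- The action of `A ⊗ A` on the tensor product of two `A`-modules. -/
def tensorAction (X Y : ModuleCat.{u} A) : A ⊗[k] A →ₐ[k]
    Module.End k ((forgetToBase k A).obj X ⊗[k] (forgetToBase k A).obj Y) :=
  (Module.endTensorEndAlgHom (A := k)).comp (Algebra.TensorProduct.map
    (Algebra.lsmul k k ((forgetToBase k A).obj X)) (Algebra.lsmul k k ((forgetToBase k A).obj Y)))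

theorem tensorAction_tmul {X Y : ModuleCat.{u} A} (a b : A) (x : (forgetToBase k A).obj X)
    (y : (forgetToBase k A).obj Y) :
    tensorAction X Y (a ⊗ₜ[k] b) (x ⊗ₜ y) = (a • x) ⊗ₜ (b • y) := rfl

/-- The tensor product of two `A`-modules. -/
abbrev tensorObj (X Y : ModuleCat.{u} A) : ModuleCat.{u} A :=
  letI : Module A ((forgetToBase k A).obj X ⊗[k] (forgetToBase k A).obj Y) :=
    Module.compHom _ ((tensorAction X Y).comp (G.comulAlgHom hG)).toRingHom
  ModuleCat.of A ((forgetToBase k A).obj X ⊗[k] (forgetToBase k A).obj Y)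

/-- The identity map, as a `k`-linear equivalence. -/
def tensorObjEquiv (X Y : ModuleCat.{u} A) :
    (forgetToBase k A).obj X ⊗[k] (forgetToBase k A).obj Y ≃ₗ[k]
      (forgetToBase k A).obj (G.tensorObj hG X Y) where
  toFun t := t
  invFun t := t
  left_inv _ := rfl
  right_inv _ := rfl
  map_add' _ _ := rfl
  map_smul' r t := by
    change r • t = tensorAction X Y (G.comulAlgHom hG (algebraMap k A r)) t
    rw [AlgHom.commutes, AlgHom.commutes]
    rfl

theorem smul_tensorObjEquiv {X Y : ModuleCat.{u} A} (a : A)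
    (t : (forgetToBase k A).obj X ⊗[k] (forgetToBase k A).obj Y) :
    a • G.tensorObjEquiv hG X Y t =
      G.tensorObjEquiv hG X Y (tensorAction X Y (G.comulOfBijective hG a) t) := rfl

/-- At `t = δ(a)` the right side is the action of `a ⊗ 1`, which makes the coevaluation `X → [Y, X ⊗
Y]` linear over `A`. -/
theorem twoSidedAction_curry {X Y : ModuleCat.{u} A} (t : A ⊗[k] Aᵐᵒᵖ)
    (x : (forgetToBase k A).obj X) (y : (forgetToBase k A).obj Y) :
    twoSidedAction k _ _ t ((G.tensorObjEquiv hG X Y).toLinearMap ∘ₗ TensorProduct.mk k _ _ x) y =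
      G.tensorObjEquiv hG X Y
        (tensorAction X Y (rightExtend (G.comulOfBijective hG) (unopTensor k A t)) (x ⊗ₜ y)) := by
  induction t with
  | zero => simp
  | add s t hs ht => simp only [map_add, LinearMap.add_apply, hs, ht]
  | tmul a b =>
    have h : unopTensor k A (a ⊗ₜ[k] b) = a ⊗ₜ b.unop := rfl
    rw [twoSidedAction_tmul, h, rightExtend_tmul, map_mul, Module.End.mul_apply,
      tensorAction_tmul, one_smul]
    rfl

/-- Uncurrying an `A`-linear `g` turns the action through `β(s)` on values of `g` into the action of
`s` on `X ⊗ Y`. Taking `s = Δ(a)`, where `β(s) = a ⊗ 1`, shows that the uncurried map is `A`-linear.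
-/
theorem twoSidedAction_canonicalMapOp {X Y Z : ModuleCat.{u} A}
    (g : (forgetToBase k A).obj X →ₗ[k] (forgetToBase k A).obj Y →ₗ[k] (forgetToBase k A).obj Z)
    (hg : ∀ (a : A) x, g (a • x) = twoSidedAction k _ _ (G.δ a) (g x))
    (s : A ⊗[k] A) (x : (forgetToBase k A).obj X) (y : (forgetToBase k A).obj Y) :
    twoSidedAction k _ _ (G.canonicalMapOp s) (g x) y =
      TensorProduct.lift g (tensorAction X Y s (x ⊗ₜ y)) := by
  induction s with
  | zero => simp
  | add s t hs ht => simp only [map_add, LinearMap.add_apply, hs, ht]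
  | tmul a b =>
    rw [canonicalMapOp_tmul, map_mul, Module.End.mul_apply, twoSidedAction_tmul, one_smul,
      tensorAction_tmul, TensorProduct.lift.tmul, hg]
    rfl

/-- The bilinear map `X → Hom_k(Y, X ⊗ Y)`. -/
def curryHom (X Y : ModuleCat.{u} A) : (forgetToBase k A).obj X →ₗ[k]
    (forgetToBase k A).obj (ihObj G.skewClosed.ihom Y (G.tensorObj hG X Y)) :=
  (G.ihomEquiv Y (G.tensorObj hG X Y)).symm.toLinearMap ∘ₗ
    LinearMap.compRight k (G.tensorObjEquiv hG X Y).toLinearMap ∘ₗ TensorProduct.mk k _ _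

theorem curryHom_smul (X Y : ModuleCat.{u} A) (a : A) (x : (forgetToBase k A).obj X) :
    G.curryHom hG X Y (a • x) = a • G.curryHom hG X Y x := by
  refine G.closedFunctor_isStrong.val_ext fun y => ?_
  rw [val_smul]
  refine Eq.trans ?_ (G.twoSidedAction_curry hG (G.δ a) x y).symm
  have h := G.rightExtend_comul_split hG a
  rw [split, LinearMap.comp_apply, AlgHom.toLinearMap_apply] at h
  rw [h, tensorAction_tmul, one_smul]
  rfl

/-- If the canonical map is bijective, tensor products lift to `A`-modules. -/
def tensorLift : G.closedFunctor.TensorLift where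
  obj := G.tensorObj hG
  μ := G.tensorObjEquiv hG
  η X Y := homOfBase k (G.curryHom hG X Y) (G.curryHom_smul hG X Y)
  val_η _ _ _ _ := rfl
  lift {X Y Z} g := homOfBase k
    (TensorProduct.lift (G.closedFunctor.val Y Z ∘ₗ baseMap k g) ∘ₗ
      (G.tensorObjEquiv hG X Y).symm.toLinearMap)
    (fun a t => by
      obtain ⟨t, rfl⟩ := (G.tensorObjEquiv hG X Y).surjective t
      rw [smul_tensorObjEquiv, LinearMap.comp_apply, LinearMap.comp_apply, LinearEquiv.coe_coe,
        LinearEquiv.symm_apply_apply, LinearEquiv.symm_apply_apply]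
      induction t with
      | zero => simp
      | add s t hs ht => simp only [map_add, smul_add, hs, ht]
      | tmul x y =>
        rw [← twoSidedAction_canonicalMapOp, G.canonicalMapOp_of_canonicalMap
          (G.canonicalMap_comul hG a), twoSidedAction_tmul,
          MulOpposite.unop_one, one_smul, TensorProduct.lift.tmul]
        exact fun b z => (congrArg _ (baseMap_smul k g b z)).trans (G.val_smul b _))
  lift_μ _ _ _ := rfl

theorem isNormal_of_bijective (hG : Function.Bijective G.canonicalMap) : G.skewClosed.IsNormal :=
  ((G.tensorLift hG).rightClosedMonoidal G.closedFunctor_isStrong).isNormal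

end Bijective

/-! ### Normality implies bijectivity, tested on the regular module -/

/-- The identity map of `A` to the underlying `k`-module of the regular module. -/
def regularEquiv (k A : Type u) [CommRing k] [Ring A] [Algebra k A] :
    A ≃ₗ[k] (forgetToBase k A).obj (ModuleCat.of A A) :=
  { AddEquiv.refl _ with map_smul' := fun r t => (_root_.algebraMap_smul A r t).symm }

/-- The map `a ⊗ b ↦ a φ(b)`. -/
def actMap {Z : ModuleCat.{u} A} (φ : A →ₗ[k] (forgetToBase k A).obj Z) :
    A ⊗[k] A →ₗ[k] (forgetToBase k A).obj Z :=
  TensorProduct.lift (LinearMap.lcomp k _ φ ∘ₗ (Algebra.lsmul k k _).toLinearMap)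

theorem actMap_tmul {Z : ModuleCat.{u} A} (φ : A →ₗ[k] (forgetToBase k A).obj Z) (a b : A) :
    actMap φ (a ⊗ₜ b) = a • φ b := rfl

theorem twoSidedAction_regular {Z : ModuleCat.{u} A} (t : A ⊗[k] Aᵐᵒᵖ)
    (φ : (forgetToBase k A).obj (ModuleCat.of A A) →ₗ[k] (forgetToBase k A).obj Z) (b : A) :
    twoSidedAction k _ _ t φ (regularEquiv k A b) =
      actMap (φ ∘ₗ (regularEquiv k A).toLinearMap) (unopTensor k A t * (1 ⊗ₜ b)) := by
  induction t with
  | zero => simp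
  | add s t hs ht => simp only [map_add, LinearMap.add_apply, add_mul, hs, ht]
  | tmul x y =>
    have h : unopTensor k A (x ⊗ₜ[k] y) = x ⊗ₜ y.unop := rfl
    rw [twoSidedAction_tmul, h, Algebra.TensorProduct.tmul_mul_tmul, mul_one, actMap_tmul]
    rfl

/-- For the regular module as source, `a₊ p(a₋ b)` depends on `a` and `b` only through `β(a ⊗ b)`;
this is how `β` enters. -/
theorem val_smul_regular {Z : ModuleCat.{u} A} (a b : A)
    (p : (forgetToBase k A).obj (ihObj G.skewClosed.ihom (ModuleCat.of A A) Z)) :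
    G.closedFunctor.val _ Z (a • p) (regularEquiv k A b) =
      actMap (G.closedFunctor.val _ Z p ∘ₗ (regularEquiv k A).toLinearMap)
        (G.canonicalMap (a ⊗ₜ b)) := by
  rw [val_smul, twoSidedAction_regular, canonicalMap_eq, rightExtend_tmul]
  rfl

/-- Normality gives an `A`-action on the tensor square of the regular module. The proof sets up maps
between this module and the free module `A ⊗ A` in both directions; relative to the identification
`M` of carriers, one of them is `β`. -/
theorem bijective_of_isNormal (hG : G.skewClosed.IsNormal) :
    Function.Bijective G.canonicalMap := by
  obtain ⟨T, -⟩ := G.closedFunctor_isStrong.exists_tensorLift hG.assoc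
  let B : ModuleCat.{u} A := ModuleCat.of A A
  -- Here `A` acts on the left tensor factor only.
  let P : ModuleCat.{u} A := ModuleCat.of A (A ⊗[k] A)
  let b : A ≃ₗ[k] (forgetToBase k A).obj B := regularEquiv k A
  let z : A ⊗[k] A ≃ₗ[k] (forgetToBase k A).obj P :=
    { AddEquiv.refl _ with map_smul' := fun r t => (_root_.algebraMap_smul A r t).symm }
  let M : A ⊗[k] A ≃ₗ[k] (forgetToBase k A).obj (T.obj B B) :=
    TensorProduct.congr b b ≪≫ₗ T.μ B B
  let κ : A ⊗[k] A →ₗ[k] (forgetToBase k A).obj (T.obj B B) :=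
    actMap (M.toLinearMap ∘ₗ TensorProduct.mk k A A 1)
  -- As `η` is `A`-linear, `η(x)(y) = (x η(1))(y) = x₊ η(1)(x₋ y)`. Hence `κ ∘ β = M`, and `β` is
  -- injective.
  have hκ (t : A ⊗[k] A) : κ (G.canonicalMap t) = M t := by
    induction t with
    | zero => simp
    | add s t hs ht => simp only [map_add, hs, ht]
    | tmul x y =>
      have h : G.closedFunctor.val B (T.obj B B) (baseMap k (T.η B B) (b 1)) ∘ₗ b.toLinearMap =
          M.toLinearMap ∘ₗ TensorProduct.mk k A A 1 :=
        LinearMap.ext fun y => T.val_η B B (b 1) (b y)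
      have hx : x • b 1 = b x := mul_one x
      refine Eq.trans ?_ (T.val_η B B (b x) (b y))
      rw [← hx, baseMap_smul]
      refine Eq.trans ?_ (G.val_smul_regular x y _).symm
      exact congrArg (fun φ => actMap φ (G.canonicalMap (x ⊗ₜ y))) h.symm
  -- The element `y ↦ 1 ⊗ y` of `[A, P]`. The `A`-linear map `g` sends `1` to it, and its lift to
  -- the tensor square is `β` on carriers.
  let u : (forgetToBase k A).obj (ihObj G.skewClosed.ihom B P) :=
    (G.ihomEquiv B P).symm (z.toLinearMap ∘ₗ TensorProduct.mk k A A 1 ∘ₗ b.symm.toLinearMap)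
  let g : B ⟶ ihObj G.skewClosed.ihom B P :=
    ModuleCat.ofHom (LinearMap.toSpanSingleton A (G.Hom B P) u)
  have hz : actMap (z.toLinearMap ∘ₗ TensorProduct.mk k A A 1) = z.toLinearMap :=
    TensorProduct.ext' fun x y => by
      refine (actMap_tmul _ x y).trans ?_
      change x • (1 ⊗ₜ[k] y : A ⊗[k] A) = x ⊗ₜ y
      rw [TensorProduct.smul_tmul', smul_eq_mul, mul_one]
  have hg (t : A ⊗[k] A) : baseMap k (T.lift g) (M t) = z (G.canonicalMap t) := by
    induction t with
    | zero => simp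
    | add s t hs ht => simp only [map_add, hs, ht]
    | tmul x y =>
      refine (T.lift_μ g (b x) (b y)).trans ((G.val_smul_regular x y u).trans ?_)
      exact LinearMap.congr_fun hz _
  -- By `A`-linearity of the lift this reduces to `1 ⊗ y`, which `β` fixes. It follows that `M⁻¹ ∘
  -- κ` is a right inverse of `β`.
  have hgκ (t : A ⊗[k] A) : baseMap k (T.lift g) (κ t) = z t := by
    induction t with
    | zero => simp
    | add s t hs ht => simp only [map_add, hs, ht]
    | tmul x y =>
      refine (baseMap_smul k (T.lift g) x (M (1 ⊗ₜ y))).trans ?_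
      rw [hg, canonicalMap_one_tmul]
      exact LinearMap.congr_fun hz (x ⊗ₜ y)
  refine ⟨Function.Injective.of_comp (f := κ) ?_, fun t => ⟨M.symm (κ t), z.injective ?_⟩⟩
  · exact (funext hκ : κ ∘ G.canonicalMap = M) ▸ M.injective
  · rw [← hg, M.apply_symm_apply, hgκ]

end GabiStructure

/-! ### The two constructions are mutually inverse -/

theorem HopfStructure.ext_of_eq {k A : Type u} [CommRing k] [Ring A] [Algebra k A]
    {H H' : HopfStructure k A} (comul : H.comul = H'.comul) (counit : H.counit = H'.counit)
    (antipode : H.antipode = H'.antipode) : H = H' := by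
  obtain ⟨@⟨⟨_, _⟩, _⟩, _⟩ := H
  obtain ⟨@⟨⟨_, _⟩, _⟩, _⟩ := H'
  cases comul
  cases counit
  cases antipode
  rfl

theorem HopfStructure.antipode_toGabiStructure {k A : Type u} [CommRing k] [Ring A] [Algebra k A]
    (H : HopfStructure k A) : H.toGabiStructure.antipode = H.antipode := by
  refine LinearMap.ext fun a => ?_
  rw [GabiStructure.antipode_apply, toGabiStructure_split]
  change TensorProduct.lid k A (H.counit.rTensor A (H.antipode.lTensor A (H.comul a))) = _
  rw [← LinearMap.comp_apply (H.counit.rTensor A), LinearMap.rTensor_comp_lTensor,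
    ← LinearMap.lTensor_comp_rTensor, LinearMap.comp_apply]
  refine (congrArg (fun t => TensorProduct.lid k A (H.antipode.lTensor k t))
    (LinearMap.congr_fun H.rTensor_counit_comp_comul a)).trans ?_
  simp

end

theorem theorem4p13 (k A : Type u) [CommRing k] [Ring A] [Algebra k A] :
    (∃ e : NormalGabiStructure k A ≃ HopfStructure k A,
      (∀ G : NormalGabiStructure k A,
        Function.Bijective G.1.canonicalMap ∧
        (∀ a : A, G.1.canonicalMap ((e G).comul a) = a ⊗ₜ[k] 1) ∧
        (e G).counit = G.1.ε.toLinearMap ∧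
        (e G).antipode = G.1.antipode) ∧
      (∀ H : HopfStructure k A,
        (e.symm H).1.ε.toLinearMap = H.counit ∧
        ∀ a : A, unopTensor k A ((e.symm H).1.δ a) = H.antipode.lTensor A (H.comul a))) ∧
    (∀ S : SkewClosed (ModuleCat.{u} A),
      List.TFAE
        [ S.IsNormal ∧ IsStrictClosed S (baseSkewClosed k) (forgetToBase k A),
          ∃ M : RightClosedMonoidal S,
            IsStrictClosedMonoidal M (baseClosedMonoidal k) (forgetToBase k A),
          ∃ M : RightClosedMonoidal S, M.IsBiclosed ∧
            IsStrictClosedMonoidal M (baseClosedMonoidal k) (forgetToBase k A) ]) := by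
  refine ⟨⟨⟨fun G => G.1.toHopfStructure (G.1.bijective_of_isNormal G.2),
    fun H => ⟨H.toGabiStructure, H.toGabiStructure.isNormal_of_bijective H.canonicalMap_bijective⟩,
    fun G => ?_, fun H => ?_⟩, fun G => ⟨G.1.bijective_of_isNormal G.2,
      G.1.canonicalMap_comul _, rfl, rfl⟩, fun H => ⟨rfl, H.unopTensor_delta⟩⟩,
    tfae_normal_closedMonoidal k⟩
  -- The map `δ` is recovered from `a₁ ⊗ σ(a₂) = a₊ ⊗ a₋`, compared in `A ⊗ A`.
  · refine Subtype.ext (GabiStructure.ext rfl (AlgHom.ext fun a => ?_))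
    refine GabiStructure.unopTensor_injective ?_
    refine (HopfStructure.unopTensor_delta _ a).trans ?_
    exact G.1.antipode_lTensor_comul _ a
  -- The comultiplication is recovered because `β` sends the given `Δ(a)` to `a₁ ⊗ S(a₂) a₃ = a ⊗
  -- 1`.
  · refine HopfStructure.ext_of_eq (LinearMap.ext fun a => ?_) rfl H.antipode_toGabiStructure
    refine (H.toGabiStructure.comul_eq_iff _).2 ?_
    rw [GabiStructure.canonicalMap_eq, HopfStructure.toGabiStructure_split]
    exact H.rightExtend_split_comul a
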